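/- Let $n\ge 3$, let $\mu_1,\dots,\mu_n\in\mathbb{C}$ with $0<|\mu_i|<1$, let $W=\mathbb{C}^n\setminus\{0\}$, $f(z_1,\dots,z_n)=(\mu_1z_1,\dots,\mu_nz_n)$, and let $X=W/\langle f\rangle$ be the corresponding Hopf manifold, with projection $\pi:W\to X$. For $b\in\mathbb{C}^*$ let $L_b$ be the holomorphic line bundle on $X$ that is the quotient of $W\times\mathbb{C}$ by the group generated by $(z,v)\mapsto(f(z),bv)$. Let $\mathcal F$ be a nonsingular one-dimensional holomorphic foliation on $X$ given by a morphism $T_{\mathcal F}=L_b\to TX$, that is, by a holomorphic bundle morphism that is injective on every fibre. A holomorphic vector field $v$ on $W$ is said to induce $\mathcal F$ if $T_{\mathcal F,\pi(z)}$ is spanned by $d\pi_z(v(z))$ for every $z\in W$. For $S\subseteq\{1,\dots,n\}$ say that there is no non-trivial relation between the $\mu_i$, $i\in S$, if for all disjoint $A,B$ with $A\cup B=S$ and all integers $r_i\ge 0$ the equality $\prod_{i\in A}\mu_i^{r_i}=\prod_{j\in B}\mu_j^{r_j}$ holds only if $r_i=0$ for all $i\in S$. (i) (Classical case.) Suppose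 $\mu_1=\dots=\mu_n=\mu$. Then $b=\mu^{-m}$ for an integer $m\ge -1$, and $\mathcal F$ is induced by a vector field $g_1\frac{\partial}{\partial z_1}+\dots+g_n\frac{\partial}{\partial z_n}$, where all $g_i$ are homogeneous polynomials of degree $m+1$ and $\{g_1=\dots=g_n=0\}$ is $\{0\}$ if $m\ge 0$, and empty if $m=-1$. (ii) (Generic case.) Suppose $|\mu_1|\le\dots\le|\mu_n|$ and there is no non-trivial relation between $\mu_1,\dots,\mu_n$. Then $b\in\{1,\mu_1,\dots,\mu_n\}$. If $b=\mu_j$, then $\mathcal F$ is induced by the constant vector field $\frac{\partial}{\partial z_j}$. If $b=1$, then $\mathcal F$ is induced by a linear vector field $\sum_{i=1}^n c_iz_i\frac{\partial}{\partial z_i}$ with $c_i\ne0$ for all $i$. (iii) (Intermediary case.) Suppose $\mu_1=\dots=\mu_r$ for some $2\le r\le n-1$ and there is no non-trivial relation between $\mu_1,\mu_{r+1},\dots,\mu_n$. Then $b\in\{1,\mu_1,\mu_{r+1},\dots,\mu_n\}$. If $b=1$, then $\mathcal F$ is induced by a vector field $\sum_{j=1}^r g_j(z_1,\dots,z_r)\frac{\partial}{\partial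 z_j}+\sum_{k=r+1}^n c_kz_k\frac{\partial}{\partial z_k}$ with linear forms $g_j$ and constants $c_k$. If $b=\mu_1$, then $\mathcal F$ is induced by a constant vector field $c_1\frac{\partial}{\partial z_1}+\dots+c_r\frac{\partial}{\partial z_r}$ with $(c_1,\dots,c_r)\ne0$. If $b=\mu_j$ with $j>r$, then $\mathcal F$ is induced by $\frac{\partial}{\partial z_j}$. -/

import Mathlib

open scoped Manifold ContDiff Topology
open MulAction

/-- The quotient of a complex manifold by a free and properly discontinuous group of biholomorphisms
is a complex manifold. -/
theorem isManifold_orbitQuotient {M : Type*} [TopologicalSpace M] {G : Type*} [Group G]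
    [MulAction G M] [ProperlyDiscontinuousSMul G M] [ContinuousConstSMul G M] [IsCancelSMul G M]
    [T2Space M] [LocallyCompactSpace M]
    {H : Type*} [TopologicalSpace H] [ChartedSpace H M]
    {E : Type*} [NormedAddCommGroup E] [NormedSpace ℂ E] (I : ModelWithCorners ℂ E H)
    [IsManifold I ω M] (hG : ∀ g : G, ContMDiff I I ω (fun m : M => g • m)) :
    IsManifold I ω (orbitRel.Quotient G M) := by
  have key : ∀ e ∈ atlas H (orbitRel.Quotient G M),
      ∃ (s : OpenPartialHomeomorph (orbitRel.Quotient G M) M) (m : M),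
        (∀ y, s.symm y = (Quotient.mk (orbitRel G M) y : orbitRel.Quotient G M)) ∧
          e = s.trans (chartAt H m) := by
    rintro e ⟨q, hq⟩
    exact ⟨_, _, fun y => congrFun (IsLocalHomeomorph.localInverseAt_symm _ _) y, hq.symm⟩
  apply isManifold_of_contDiffOn
  intro e e' he he' x hx
  obtain ⟨s, m, hs, rfl⟩ := key e he
  obtain ⟨s', m', hs', rfl⟩ := key e' he'
  simp only [OpenPartialHomeomorph.trans_symm_eq_symm_trans_symm, Set.mem_inter_iff,
    Set.mem_preimage, OpenPartialHomeomorph.trans_source, OpenPartialHomeomorph.symm_source,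
    OpenPartialHomeomorph.coe_trans, Function.comp_apply, Set.mem_range, hs] at hx
  obtain ⟨⟨⟨h1, h2⟩, h3, h4⟩, h5⟩ := hx
  set p : M := (chartAt H m).symm (I.symm x) with hp
  have hxt : x ∈ (extChartAt I m).target := by
    rw [extChartAt_target]; exact ⟨h1, h5⟩
  have hq : (Quotient.mk (orbitRel G M) (s' (Quotient.mk (orbitRel G M) p)) :
      orbitRel.Quotient G M) = Quotient.mk (orbitRel G M) p := by
    rw [← hs']; exact s'.left_inv h3
  obtain ⟨g, hg⟩ : ∃ g : G, g • p = s' (Quotient.mk (orbitRel G M) p) := Quotient.exact hq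
  have hgp : g • p ∈ s'.target := hg ▸ s'.map_source h3
  have hcont : Continuous (fun y : M => g • y) := continuous_const_smul g
  have hev : ∀ᶠ y in 𝓝 p, s' (Quotient.mk (orbitRel G M) y) = g • y := by
    filter_upwards [hcont.continuousAt.preimage_mem_nhds (s'.open_target.mem_nhds hgp)] with y hy
    have : (Quotient.mk (orbitRel G M) y : orbitRel.Quotient G M)
        = Quotient.mk (orbitRel G M) (g • y) :=
      Quotient.sound (by exact ⟨g⁻¹, by simp⟩)
    rw [this, ← hs', s'.right_inv hy]
  have hsymm : ContMDiffWithinAt 𝓘(ℂ, E) I ω (extChartAt I m).symm (extChartAt I m).target x :=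
    contMDiffOn_extChartAt_symm m x hxt
  have hpe : (extChartAt I m).symm x = p := by simp [hp]
  have hm : ContMDiffAt I 𝓘(ℂ, E) ω (extChartAt I m') (g • p) := by
    apply contMDiffAt_extChartAt'
    rw [hg]; exact h4
  have hcomp : ContMDiffAt I 𝓘(ℂ, E) ω (fun y => extChartAt I m' (g • y)) p :=
    ContMDiffAt.comp p hm (hG g p)
  have h6 : ContMDiffWithinAt 𝓘(ℂ, E) 𝓘(ℂ, E) ω
      (fun y => extChartAt I m' (g • (extChartAt I m).symm y)) (extChartAt I m).target x := by
    rw [← hpe] at hcomp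
    exact hcomp.comp_contMDiffWithinAt x hsymm
  rw [contMDiffWithinAt_iff_contDiffWithinAt] at h6
  have hsub : (I.symm ⁻¹' ((s.trans (chartAt H m)).symm.trans
      (s'.trans (chartAt H m'))).source ∩ Set.range I) ⊆ (extChartAt I m).target := by
    rintro y ⟨hy1, hy2⟩
    rw [extChartAt_target]
    refine ⟨?_, hy2⟩
    simp only [OpenPartialHomeomorph.trans_symm_eq_symm_trans_symm, Set.mem_inter_iff,
      Set.mem_preimage, OpenPartialHomeomorph.trans_source,
      OpenPartialHomeomorph.symm_source] at hy1
    exact hy1.1.1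
  have hev' := (hpe ▸ hsymm.continuousWithinAt.tendsto).eventually hev
  refine (h6.congr_of_eventuallyEq ?_ ?_).mono hsub
  · filter_upwards [hev'] with y hy
    simp only [Function.comp_apply, OpenPartialHomeomorph.coe_trans,
      OpenPartialHomeomorph.trans_symm_eq_symm_trans_symm, hs, extChartAt_coe, extChartAt_coe_symm]
      at hy ⊢
    rw [hy]
  · simp only [Function.comp_apply, OpenPartialHomeomorph.coe_trans,
      OpenPartialHomeomorph.trans_symm_eq_symm_trans_symm, hs, extChartAt_coe, extChartAt_coe_symm,
      ← hp, hg]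

/-- `W = ℂⁿ ∖ {0}`. -/
def puncturedSpace (n : ℕ) : TopologicalSpace.Opens (Fin n → ℂ) :=
  ⟨{0}ᶜ, isOpen_compl_singleton⟩

instance (n : ℕ) : LocallyCompactSpace (puncturedSpace n) :=
  (puncturedSpace n).isOpen.locallyCompactSpace

/-- The numbers `μ₁, …, μₙ` with `0 < |μᵢ| < 1` that define a diagonal contraction of `ℂⁿ`. -/
structure DiagonalContraction (n : ℕ) where
  /-- The numbers `μᵢ`. -/
  mult : Fin n → ℂ
  norm_pos : ∀ i, 0 < ‖mult i‖
  norm_lt_one : ∀ i, ‖mult i‖ < 1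

namespace DiagonalContraction

variable {n : ℕ} (μ : DiagonalContraction n)

theorem mult_ne_zero (i : Fin n) : μ.mult i ≠ 0 := norm_pos_iff.mp (μ.norm_pos i)

/-- The contraction `f (z₁, …, zₙ) = (μ₁ z₁, …, μₙ zₙ)`, as a bijection of `W = ℂⁿ ∖ {0}`. -/
noncomputable def toPerm : Equiv.Perm (puncturedSpace n) where
  toFun z := ⟨fun i => μ.mult i * z.1 i, fun h => z.2 (by
    funext i
    have := congrFun (show (fun i => μ.mult i * z.1 i) = 0 from h) i
    simpa [μ.mult_ne_zero i] using this)⟩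
  invFun z := ⟨fun i => (μ.mult i)⁻¹ * z.1 i, fun h => z.2 (by
    funext i
    have := congrFun (show (fun i => (μ.mult i)⁻¹ * z.1 i) = 0 from h) i
    simpa [μ.mult_ne_zero i] using this)⟩
  left_inv z := by ext i; simp [μ.mult_ne_zero i]
  right_inv z := by ext i; simp [μ.mult_ne_zero i]

/-- The bijection `(z, v) ↦ (f z, b v)` of `W × ℂ`. -/
noncomputable def toPermLine (b : ℂˣ) : Equiv.Perm (puncturedSpace n × ℂ) :=
  Equiv.prodCongr μ.toPerm (Units.mulLeft b)

theorem toPerm_zpow_apply (k : ℤ) (z : puncturedSpace n) (i : Fin n) :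
    ((μ.toPerm ^ k) z).1 i = μ.mult i ^ k * z.1 i := by
  induction k generalizing z with
  | zero => simp
  | succ k ih =>
    rw [zpow_add_one, Equiv.Perm.mul_apply, ih, zpow_add_one₀ (μ.mult_ne_zero i), mul_assoc]; rfl
  | pred k ih =>
    rw [zpow_sub_one, Equiv.Perm.mul_apply, ih, zpow_sub_one₀ (μ.mult_ne_zero i), mul_assoc]; rfl

theorem toPermLine_zpow_apply (b : ℂˣ) (k : ℤ) (p : puncturedSpace n × ℂ) :
    (μ.toPermLine b ^ k) p = ((μ.toPerm ^ k) p.1, (b : ℂ) ^ k * p.2) := by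
  induction k generalizing p with
  | zero => simp
  | succ k ih =>
    rw [zpow_add_one, zpow_add_one, Equiv.Perm.mul_apply, ih, zpow_add_one₀ b.ne_zero, mul_assoc]
    rfl
  | pred k ih =>
    rw [zpow_sub_one, zpow_sub_one, Equiv.Perm.mul_apply, ih, zpow_sub_one₀ b.ne_zero, mul_assoc,
      ← Units.val_inv_eq_inv_val]
    rfl

theorem exists_norm_zpow_le : ∃ c : ℝ, 0 ≤ c ∧ c < 1 ∧ ∀ (k : ℕ) (z : puncturedSpace n),
    ‖((μ.toPerm ^ (k : ℤ)) z).1‖ ≤ c ^ k * ‖z.1‖ := by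
  obtain ⟨c, hc0, hc1, hc⟩ : ∃ c : ℝ, 0 ≤ c ∧ c < 1 ∧ ∀ i, ‖μ.mult i‖ ≤ c := by
    refine ⟨((Finset.univ.sup fun i => ‖μ.mult i‖₊ : NNReal) : ℝ), NNReal.coe_nonneg _, ?_, ?_⟩
    · rw [← NNReal.coe_one, NNReal.coe_lt_coe, Finset.sup_lt_iff (by simp)]
      exact fun i _ => μ.norm_lt_one i
    · intro i
      exact Finset.le_sup (f := fun i => ‖μ.mult i‖₊) (Finset.mem_univ i)
  refine ⟨c, hc0, hc1, fun k z => ?_⟩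
  rw [pi_norm_le_iff_of_nonneg (by positivity)]
  intro i
  rw [toPerm_zpow_apply, zpow_natCast, norm_mul, norm_pow]
  gcongr
  · exact hc i
  · exact norm_le_pi_norm z.1 i

theorem zpow_eq_zero_of_fixed {k : ℤ} {z : puncturedSpace n} (h : (μ.toPerm ^ k) z = z) :
    k = 0 := by
  obtain ⟨c, hc0, hc1, hc⟩ := μ.exists_norm_zpow_le
  have hz : 0 < ‖z.1‖ := norm_pos_iff.mpr z.2
  have main : ∀ j : ℕ, (μ.toPerm ^ (j : ℤ)) z = z → j = 0 := by
    intro j hj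
    by_contra hj0
    have h1 := hc j z
    rw [hj] at h1
    have h2 : c ^ j < 1 := pow_lt_one₀ hc0 hc1 hj0
    nlinarith
  obtain ⟨j, rfl | rfl⟩ := k.eq_nat_or_neg
  · exact_mod_cast main j h
  · have : (μ.toPerm ^ (j : ℤ)) z = z := by
      conv_lhs => rw [← h]
      rw [← Equiv.Perm.mul_apply, ← zpow_add]; simp
    simpa using main j this

theorem finite_zpow_inter {K L : Set (puncturedSpace n)} (hK : IsCompact K) (hL : IsCompact L) :
    {k : ℤ | ∃ z ∈ K, (μ.toPerm ^ k) z ∈ L}.Finite := by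
  obtain ⟨c, hc0, hc1, hc⟩ := μ.exists_norm_zpow_le
  have hcont : Continuous fun z : puncturedSpace n => ‖z.1‖ := by fun_prop
  have main : ∀ {K L : Set (puncturedSpace n)}, IsCompact K → IsCompact L →
      ∃ N : ℕ, ∀ k : ℕ, ∀ z ∈ K, (μ.toPerm ^ (k : ℤ)) z ∈ L → k < N := by
    intro K L hK hL
    rcases L.eq_empty_or_nonempty with rfl | hLne
    · exact ⟨0, by simp⟩
    obtain ⟨w, hwL, hw⟩ := hL.exists_isMinOn hLne hcont.continuousOn
    obtain ⟨A, hA⟩ := (hK.image hcont).bddAbove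
    have hw0 : 0 < ‖w.1‖ := norm_pos_iff.mpr w.2
    have htend : Filter.Tendsto (fun k : ℕ => c ^ k * A) Filter.atTop (𝓝 (0 * A)) :=
      (tendsto_pow_atTop_nhds_zero_of_lt_one hc0 hc1).mul_const A
    rw [zero_mul] at htend
    obtain ⟨N, hN⟩ := Filter.eventually_atTop.mp (htend.eventually_lt_const hw0)
    refine ⟨N, fun k z hz hkz => ?_⟩
    by_contra hk
    have h1 := hN k (not_lt.mp hk)
    have h2 : ‖w.1‖ ≤ ‖((μ.toPerm ^ (k : ℤ)) z).1‖ := hw hkz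
    have h3 := hc k z
    have h4 : ‖z.1‖ ≤ A := hA ⟨z, hz, rfl⟩
    have h5 : c ^ k * ‖z.1‖ ≤ c ^ k * A := by gcongr
    linarith
  obtain ⟨N₁, hN₁⟩ := main hK hL
  obtain ⟨N₂, hN₂⟩ := main hL hK
  refine (Set.finite_Icc (-(N₂ : ℤ)) N₁).subset ?_
  rintro k ⟨z, hzK, hzL⟩
  obtain ⟨j, rfl | rfl⟩ := k.eq_nat_or_neg
  · have := hN₁ j z hzK hzL
    constructor <;> omega
  · have := hN₂ j _ hzL (by rw [← Equiv.Perm.mul_apply, ← zpow_add]; simpa using hzK)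
    constructor <;> omega

theorem contMDiff_toPerm_zpow (k : ℤ) :
    ContMDiff 𝓘(ℂ, Fin n → ℂ) 𝓘(ℂ, Fin n → ℂ) ω (μ.toPerm ^ k : Equiv.Perm _) := by
  have h : ContMDiff 𝓘(ℂ, Fin n → ℂ) 𝓘(ℂ, Fin n → ℂ) ω
      (fun z : puncturedSpace n => (fun i => μ.mult i ^ k * z.1 i : Fin n → ℂ)) := by
    have : ContDiff ℂ ω (fun z : Fin n → ℂ => (fun i => μ.mult i ^ k * z i : Fin n → ℂ)) := by
      fun_prop
    exact this.contMDiff.comp contMDiff_subtype_val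
  intro z
  refine (ChartedSpace.liftPropWithinAt_subtypeVal_comp_iff (U := puncturedSpace n) _ _ _).mp ?_
  refine (h z).congr_of_eventuallyEq (Filter.Eventually.of_forall fun w => ?_)
  funext i
  exact μ.toPerm_zpow_apply k w i

instance : ContinuousConstSMul (Subgroup.zpowers μ.toPerm) (puncturedSpace n) where
  continuous_const_smul := by
    rintro ⟨_, k, rfl⟩
    exact (μ.contMDiff_toPerm_zpow k).continuous

instance : IsCancelSMul (Subgroup.zpowers μ.toPerm) (puncturedSpace n) := by
  rw [isCancelSMul_iff_eq_one_of_smul_eq]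
  rintro ⟨_, k, rfl⟩ z hz
  have hk : k = 0 := μ.zpow_eq_zero_of_fixed (z := z) hz
  subst hk
  exact Subtype.ext (zpow_zero _)

instance : ProperlyDiscontinuousSMul (Subgroup.zpowers μ.toPerm) (puncturedSpace n) where
  finite_disjoint_inter_image {K L} hK hL := by
    refine ((μ.finite_zpow_inter hK hL).image
      fun k => (⟨μ.toPerm ^ k, k, rfl⟩ : Subgroup.zpowers μ.toPerm)).subset ?_
    rintro ⟨_, k, rfl⟩ ⟨_, ⟨z, hz, rfl⟩, hzL⟩
    exact ⟨k, ⟨z, hz, hzL⟩, rfl⟩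

/-- The Hopf manifold `X = W / ⟨f⟩`. Topology and charts are Mathlib's ones on the quotient by a free
properly discontinuous action. -/
noncomputable abbrev HopfManifold : Type :=
  orbitRel.Quotient (Subgroup.zpowers μ.toPerm) (puncturedSpace n)

instance : IsManifold 𝓘(ℂ, Fin n → ℂ) ω μ.HopfManifold :=
  isManifold_orbitQuotient _ (by rintro ⟨_, k, rfl⟩; exact μ.contMDiff_toPerm_zpow k)

/-- The natural projection `π : W → X`. -/
noncomputable def proj (z : puncturedSpace n) : μ.HopfManifold := Quotient.mk _ z

variable (b : ℂˣ)

theorem contMDiff_toPermLine_zpow (k : ℤ) :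
    ContMDiff (𝓘(ℂ, Fin n → ℂ).prod 𝓘(ℂ, ℂ)) (𝓘(ℂ, Fin n → ℂ).prod 𝓘(ℂ, ℂ)) ω
      (μ.toPermLine b ^ k : Equiv.Perm _) := by
  have h2 : ContMDiff 𝓘(ℂ, ℂ) 𝓘(ℂ, ℂ) ω (fun v : ℂ => (b : ℂ) ^ k * v) := by
    rw [contMDiff_iff_contDiff]; fun_prop
  refine ((μ.contMDiff_toPerm_zpow k).prodMap h2).congr fun p => ?_
  exact μ.toPermLine_zpow_apply b k p

instance : ContinuousConstSMul (Subgroup.zpowers (μ.toPermLine b)) (puncturedSpace n × ℂ) where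
  continuous_const_smul := by
    rintro ⟨_, k, rfl⟩
    exact (μ.contMDiff_toPermLine_zpow b k).continuous

instance : IsCancelSMul (Subgroup.zpowers (μ.toPermLine b)) (puncturedSpace n × ℂ) := by
  rw [isCancelSMul_iff_eq_one_of_smul_eq]
  rintro ⟨_, k, rfl⟩ p hp
  have hp' : (μ.toPermLine b ^ k) p = p := hp
  rw [toPermLine_zpow_apply] at hp'
  have hk : k = 0 := μ.zpow_eq_zero_of_fixed (congrArg Prod.fst hp')
  subst hk
  exact Subtype.ext (zpow_zero _)

instance : ProperlyDiscontinuousSMul (Subgroup.zpowers (μ.toPermLine b))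
    (puncturedSpace n × ℂ) where
  finite_disjoint_inter_image {K L} hK hL := by
    refine ((μ.finite_zpow_inter (hK.image continuous_fst) (hL.image continuous_fst)).image
      fun k => (⟨μ.toPermLine b ^ k, k, rfl⟩ : Subgroup.zpowers (μ.toPermLine b))).subset ?_
    rintro ⟨_, k, rfl⟩ ⟨_, ⟨p, hp, rfl⟩, hpL⟩
    have hpL' : (μ.toPermLine b ^ k) p ∈ L := hpL
    rw [toPermLine_zpow_apply] at hpL'
    exact ⟨k, ⟨p.1, ⟨p, hp, rfl⟩, ⟨_, hpL', rfl⟩⟩, rfl⟩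

/-- The total space of the line bundle `L_b = (W × ℂ) / ⟨(z, v) ↦ (f z, b v)⟩`, a complex manifold of
dimension `n + 1`. -/
noncomputable abbrev LineBundle : Type :=
  orbitRel.Quotient (Subgroup.zpowers (μ.toPermLine b)) (puncturedSpace n × ℂ)

instance : IsManifold (𝓘(ℂ, Fin n → ℂ).prod 𝓘(ℂ, ℂ)) ω (μ.LineBundle b) :=
  isManifold_orbitQuotient _ (by rintro ⟨_, k, rfl⟩; exact μ.contMDiff_toPermLine_zpow b k)

/-- The class `[z, v]` in `L_b`. For fixed `z`, the map `v ↦ [z, v]` is the linear coordinate of the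
fibre of `L_b` over `π z`. -/
noncomputable def LineBundle.mk (z : puncturedSpace n) (v : ℂ) : μ.LineBundle b := Quotient.mk _ (z, v)

/-- A nonsingular one-dimensional holomorphic foliation on `X` given by a morphism
`T_F = L_b → TX`: a holomorphic map of total spaces that covers the identity of `X` and is linear and
injective on every fibre. (The image is a line subbundle of `TX`; a line subbundle is involutive.) -/
structure Foliation where
  /-- The morphism `L_b → TX`. -/
  toFun : μ.LineBundle b → TangentBundle 𝓘(ℂ, Fin n → ℂ) μ.HopfManifold
  holomorphic : MDifferentiable (𝓘(ℂ, Fin n → ℂ).prod 𝓘(ℂ, ℂ)) 𝓘(ℂ, Fin n → ℂ).tangent toFun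
  fiberwise : ∀ z : puncturedSpace n,
    ∃ A : ℂ →ₗ[ℂ] TangentSpace 𝓘(ℂ, Fin n → ℂ) (μ.proj z), Function.Injective A ∧
      ∀ v : ℂ, toFun (LineBundle.mk μ b z v) = ⟨μ.proj z, A v⟩

variable {μ b}

/-- The fibre of `T_F ⊆ TX` at `x`. -/
def Foliation.tangentLine (F : μ.Foliation b) (x : μ.HopfManifold) :
    Set (TangentSpace 𝓘(ℂ, Fin n → ℂ) x) :=
  {u | (⟨x, u⟩ : TangentBundle 𝓘(ℂ, Fin n → ℂ) μ.HopfManifold) ∈ Set.range F.toFun}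

/-- `F` is induced by the vector field `∑ vᵢ ∂/∂zᵢ` on `W`: for every `z` in `W` the line of `F` at
`π z` is spanned by the image of the vector `v z` under the derivative of `π`. -/
def Foliation.IsInducedBy (F : μ.Foliation b) (v : (Fin n → ℂ) → (Fin n → ℂ)) : Prop :=
  ∀ z : puncturedSpace n, F.tangentLine (μ.proj z) =
    Submodule.span ℂ
      {mfderiv 𝓘(ℂ, Fin n → ℂ) 𝓘(ℂ, Fin n → ℂ) μ.proj z
        (v z : TangentSpace 𝓘(ℂ, Fin n → ℂ) z)}

variable (μ)

/-- `μ₁ = ⋯ = μₙ = a`. -/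
def IsClassical (a : ℂ) : Prop := ∀ i, μ.mult i = a

/-- There is no non-trivial relation `∏_{i ∈ A} μᵢ ^ eᵢ = ∏_{j ∈ B} μⱼ ^ eⱼ` with natural exponents,
`A` and `B` disjoint and `A ∪ B = S`. -/
def NoRelation (S : Finset (Fin n)) : Prop :=
  ∀ A B : Finset (Fin n), Disjoint A B → A ∪ B = S → ∀ e : Fin n → ℕ,
    ∏ i ∈ A, μ.mult i ^ e i = ∏ j ∈ B, μ.mult j ^ e j → ∀ i ∈ S, e i = 0

/-- `|μ₁| ≤ ⋯ ≤ |μₙ|`, without a non-trivial relation between `μ₁, …, μₙ`. -/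
def IsGeneric : Prop := (Monotone fun i => ‖μ.mult i‖) ∧ μ.NoRelation Finset.univ

/-- The indices `1, r + 1, …, n` (as elements of `Fin n`: `0, r, …, n - 1`). -/
def intermediaryIndices (n r : ℕ) : Finset (Fin n) :=
  Finset.univ.filter fun i => (i : ℕ) = 0 ∨ r ≤ (i : ℕ)

/-- `μ₁ = ⋯ = μᵣ` where `2 ≤ r ≤ n - 1`, without a non-trivial relation between
`μ₁, μᵣ₊₁, …, μₙ`. -/
def IsIntermediary (r : ℕ) : Prop :=
  2 ≤ r ∧ r + 1 ≤ n ∧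
    (∀ i j : Fin n, (i : ℕ) < r → (j : ℕ) < r → μ.mult i = μ.mult j) ∧
    μ.NoRelation (intermediaryIndices n r)

end DiagonalContraction

/-- The vector field `∑_{j ≤ r} g_j ∂/∂z_j + ∑_{k > r} c_k z_k ∂/∂z_k`, where
`g_j = ∑_{i ≤ r} A_{ji} z_i` are linear forms in `z₁, …, zᵣ`. -/
def blockLinearField {n : ℕ} (r : ℕ) (A : Matrix (Fin n) (Fin n) ℂ) (c : Fin n → ℂ)
    (z : Fin n → ℂ) : Fin n → ℂ :=
  fun j => if (j : ℕ) < r then ∑ i with i.val < r, A j i * z i else c j * z j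

/-! Pulled back to `W`, the morphism `L_b → TX` becomes a vector field `U` without zeros, because
both bundles are trivial there. The identity `[f z, b] = [z, 1]` in `L_b` turns into `b U_i(f z) =
μ_i U_i(z)`: each component is a holomorphic function on `ℂⁿ ∖ {0}` that `f` multiplies by the
constant `μ_i / b`.

Such a function is a polynomial (`exists_mvPolynomial_of_equivariant`). The functional equation
carries a bound on a compact annulus to a bound by a power of `‖z‖` at infinity. By Liouville the
function is then a polynomial along every line in the direction of the first coordinate that misses
the origin, and Lagrange interpolation between hyperplanes off the origin assembles a single
polynomial. Comparison of coefficients shows that `z ^ α` occurs in `U_i` only if `b μ ^ α = μ_i`.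

The rest is arithmetic of this equation. If all `μ_i` equal `a`, it fixes the degree `|α|`.
Otherwise `U(e_j) ≠ 0` gives an equation `b μ_j ^ k = μ_i` for every `j`, and two such equations
leave only `b = 1` or `b = μ_s` (`IsReduction.eq_one_or_eq_mult`). For `b = 1` only linear monomials
survive, for `b = μ_s` only constants. A map `τ` onto representatives of equal multipliers treats
the generic and the intermediary case together. -/

/-! ### Holomorphic functions of polynomial growth -/

/-- Induction on `N`: the quotient `(g z - g 0) / z` is entire and its growth exponent is one lower;
Liouville's theorem is the case `N = 0`. -/
theorem Complex.exists_polynomial_of_growth {g : ℂ → ℂ} (hg : Differentiable ℂ g) {C : ℝ} {N : ℕ}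
    (h : ∀ z, ‖g z‖ ≤ C * (1 + ‖z‖) ^ N) :
    ∃ p : Polynomial ℂ, p.natDegree ≤ N ∧ ∀ z, g z = p.eval z := by
  induction N generalizing g C with
  | zero =>
    have hb : Bornology.IsBounded (Set.range g) := by
      rw [isBounded_iff_forall_norm_le]
      refine ⟨C, ?_⟩
      rintro _ ⟨z, rfl⟩
      simpa using h z
    obtain ⟨c, hc⟩ := hg.exists_const_forall_eq_of_bounded hb
    exact ⟨Polynomial.C c, by simp, fun z => by simp [hc z]⟩
  | succ N ih =>
    have hq : Differentiable ℂ (dslope g 0) := by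
      rw [← differentiableOn_univ, Complex.differentiableOn_dslope Filter.univ_mem]
      exact hg.differentiableOn
    obtain ⟨B, hB⟩ := (isCompact_closedBall (0 : ℂ) 1).exists_bound_of_continuousOn
      hq.continuous.continuousOn
    have hC : 0 ≤ C := by
      have := (norm_nonneg _).trans (h 0)
      simpa using this
    -- `B` serves the unit disc. Outside it `1 ≤ ‖z‖` absorbs both `g 0` and the factor `1 + ‖z‖`
    -- into `4 * ‖z‖`.
    have hgrowth : ∀ z, ‖dslope g 0 z‖ ≤ max (4 * C) B * (1 + ‖z‖) ^ N := by
      intro z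
      have h1 : (1 : ℝ) ≤ (1 + ‖z‖) ^ N := one_le_pow₀ (by linarith [norm_nonneg z])
      rcases le_or_gt ‖z‖ 1 with hz | hz
      · have h2 := hB z (by simpa using hz)
        calc ‖dslope g 0 z‖ ≤ max (4 * C) B := h2.trans (le_max_right _ _)
          _ ≤ _ := le_mul_of_one_le_right ((norm_nonneg _).trans (h2.trans (le_max_right _ _))) h1
      · have hz0 : z ≠ 0 := by rintro rfl; simp at hz; linarith
        have h3 : ‖dslope g 0 z‖ * ‖z‖ = ‖g z - g 0‖ := by
          rw [dslope_of_ne _ hz0, slope_def_field, sub_zero, norm_div,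
            div_mul_cancel₀ _ (norm_ne_zero_iff.mpr hz0)]
        have h4 : ‖g z - g 0‖ ≤ C * (1 + ‖z‖) ^ (N + 1) + C := by
          have := h 0
          simp only [norm_zero, add_zero, one_pow, mul_one] at this
          exact (norm_sub_le _ _).trans (add_le_add (h z) this)
        have h5 : C * (1 + ‖z‖) ^ (N + 1) + C ≤ (4 * C * (1 + ‖z‖) ^ N) * ‖z‖ := by
          set t := (1 + ‖z‖) ^ N
          rw [pow_succ]
          have : 0 ≤ C * t * (‖z‖ - 1) := by
            have : 0 ≤ t := by linarith
            have : 0 ≤ ‖z‖ - 1 := by linarith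
            positivity
          have : C ≤ C * t := le_mul_of_one_le_right hC h1
          change C * (t * (1 + ‖z‖)) + C ≤ _
          nlinarith
        have h6 : ‖dslope g 0 z‖ ≤ 4 * C * (1 + ‖z‖) ^ N := by
          rw [← h3] at h4
          exact le_of_mul_le_mul_right (h4.trans h5) (by linarith)
        exact h6.trans (by gcongr; exact le_max_left _ _)
    obtain ⟨p, hp, hpz⟩ := ih hq hgrowth
    refine ⟨Polynomial.X * p + Polynomial.C (g 0), ?_, fun z => ?_⟩
    · refine (Polynomial.natDegree_add_C (a := g 0)).le.trans ?_
      refine Polynomial.natDegree_mul_le.trans ?_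
      rw [Polynomial.natDegree_X]; omega
    · have := sub_smul_dslope g 0 z
      simp only [Polynomial.eval_add, Polynomial.eval_mul, Polynomial.eval_X, Polynomial.eval_C,
        ← hpz z]
      simp only [sub_zero, smul_eq_mul] at this
      rw [this]; ring

/-- The Lagrange basis polynomial of degree `N` for the nodes `1, …, N + 1` that is `1` at the node
`j + 1`. -/
noncomputable def lagrangeNode (N j : ℕ) : Polynomial ℂ :=
  Lagrange.basis (Finset.range (N + 1)) (fun i : ℕ => (i : ℂ) + 1) j

/-- The nodes start at 1 rather than 0 so that the hyperplanes `z₀ = j + 1` avoid the origin, where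
the functions of interest are not defined. -/
theorem Polynomial.eval_eq_sum_lagrangeNode {p : Polynomial ℂ} {N : ℕ} (hp : p.natDegree ≤ N)
    (w : ℂ) : p.eval w =
      ∑ j ∈ Finset.range (N + 1), p.eval ((j : ℂ) + 1) * (lagrangeNode N j).eval w := by
  have hinj : Set.InjOn (fun i : ℕ => (i : ℂ) + 1) (Finset.range (N + 1)) := by
    intro i _ j _ hij
    simpa using hij
  have hdeg : p.degree < (Finset.range (N + 1)).card := by
    rw [Finset.card_range]
    exact (Polynomial.degree_le_of_natDegree_le hp).trans_lt (by exact_mod_cast Nat.lt_succ_self N)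
  conv_lhs => rw [Lagrange.eq_interpolate hinj hdeg]
  simp [Lagrange.interpolate_apply, Polynomial.eval_finsetSum, lagrangeNode]

theorem norm_cons_le {m : ℕ} (w : ℂ) (z : Fin m → ℂ) :
    ‖(Fin.cons w z : Fin (m + 1) → ℂ)‖ ≤ ‖w‖ + ‖z‖ := by
  rw [pi_norm_le_iff_of_nonneg (by positivity)]
  intro i
  refine Fin.cases ?_ (fun j => ?_) i
  · simp
  · simpa using (norm_le_pi_norm z j).trans (by linarith [norm_nonneg w])

theorem norm_le_norm_cons {m : ℕ} (w : ℂ) (z : Fin m → ℂ) :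
    ‖w‖ ≤ ‖(Fin.cons w z : Fin (m + 1) → ℂ)‖ := by
  simpa using norm_le_pi_norm (Fin.cons w z : Fin (m + 1) → ℂ) 0

theorem differentiable_cons_left {m : ℕ} (z : Fin m → ℂ) :
    Differentiable ℂ fun w : ℂ => (Fin.cons w z : Fin (m + 1) → ℂ) := by
  rw [differentiable_pi]
  intro i
  refine Fin.cases ?_ (fun j => ?_) i <;> simp

theorem differentiable_cons_right {m : ℕ} (w : ℂ) :
    Differentiable ℂ fun z : Fin m → ℂ => (Fin.cons w z : Fin (m + 1) → ℂ) := by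
  rw [differentiable_pi]
  intro i
  refine Fin.cases ?_ (fun j => ?_) i
  · simp
  · simp only [Fin.cons_succ]; fun_prop

/-- The polynomial that interpolates the polynomials `p j`, prescribed on the hyperplanes
`z₀ = j + 1`. -/
noncomputable def MvPolynomial.interpolateHyperplanes {m : ℕ} (N : ℕ)
    (p : ℕ → MvPolynomial (Fin m) ℂ) : MvPolynomial (Fin (m + 1)) ℂ :=
  ∑ j ∈ Finset.range (N + 1),
    MvPolynomial.rename Fin.succ (p j) * Polynomial.aeval (MvPolynomial.X 0) (lagrangeNode N j)

theorem MvPolynomial.eval_interpolateHyperplanes {m : ℕ} (N : ℕ)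
    (p : ℕ → MvPolynomial (Fin m) ℂ) (w : ℂ) (z : Fin m → ℂ) :
    MvPolynomial.eval (Fin.cons w z) (interpolateHyperplanes N p) =
      ∑ j ∈ Finset.range (N + 1), MvPolynomial.eval z (p j) * (lagrangeNode N j).eval w := by
  rw [interpolateHyperplanes, map_sum]
  refine Finset.sum_congr rfl fun j _ => ?_
  rw [map_mul, MvPolynomial.eval_rename]
  congr 1
  have h := Polynomial.hom_eval₂ (lagrangeNode N j) (algebraMap ℂ (MvPolynomial (Fin (m + 1)) ℂ))
    (MvPolynomial.eval (Fin.cons w z)) (MvPolynomial.X 0)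
  rw [Polynomial.aeval_def, h, MvPolynomial.eval_X, Fin.cons_zero]
  have : (MvPolynomial.eval (Fin.cons w z : Fin (m + 1) → ℂ)).comp
      (algebraMap ℂ (MvPolynomial (Fin (m + 1)) ℂ)) = RingHom.id ℂ := by
    ext x; simp [MvPolynomial.algebraMap_eq]
  rw [this]; rfl

/-- Induction on the number of variables. On each hyperplane `z₀ = w` the function is a polynomial
by induction; along each line in direction `z₀` it is a polynomial of degree at most `N`, hence
determined by its values on `N + 1` hyperplanes. -/
theorem exists_mvPolynomial_of_growth {m : ℕ} {g : (Fin m → ℂ) → ℂ} (hg : Differentiable ℂ g)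
    {C : ℝ} {N : ℕ} (h : ∀ z, ‖g z‖ ≤ C * (1 + ‖z‖) ^ N) :
    ∃ p : MvPolynomial (Fin m) ℂ, ∀ z, g z = MvPolynomial.eval z p := by
  induction m generalizing C with
  | zero =>
    refine ⟨MvPolynomial.C (g 0), fun z => ?_⟩
    rw [MvPolynomial.eval_C, Subsingleton.elim z 0]
  | succ m ih =>
    have hC : 0 ≤ C := by simpa using (norm_nonneg _).trans (h 0)
    have hslice : ∀ w : ℂ, ∃ p : MvPolynomial (Fin m) ℂ, ∀ z : Fin m → ℂ,
        g (Fin.cons w z) = MvPolynomial.eval z p := by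
      intro w
      -- The constant comes from `1 + ‖(w, z)‖ ≤ (1 + ‖w‖) * (1 + ‖z‖)`.
      refine ih (g := fun z => g (Fin.cons w z)) (hg.comp (differentiable_cons_right w))
        (C := C * (1 + ‖w‖) ^ N) fun z => ?_
      refine (h _).trans ?_
      rw [mul_assoc, ← mul_pow]
      gcongr
      nlinarith [norm_cons_le w z, norm_nonneg w, norm_nonneg z,
        mul_nonneg (norm_nonneg w) (norm_nonneg z)]
    choose p hp using hslice
    refine ⟨MvPolynomial.interpolateHyperplanes N fun j => p ((j : ℂ) + 1), fun z => ?_⟩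
    rw [← Fin.cons_self_tail z, MvPolynomial.eval_interpolateHyperplanes]
    obtain ⟨q, hq, hqz⟩ := Complex.exists_polynomial_of_growth
      (hg.comp (differentiable_cons_left (Fin.tail z))) (C := C * (1 + ‖Fin.tail z‖) ^ N) (N := N)
      fun w => by
        refine (h _).trans ?_
        rw [mul_assoc, ← mul_pow]
        gcongr
        nlinarith [norm_cons_le w (Fin.tail z), norm_nonneg w, norm_nonneg (Fin.tail z),
          mul_nonneg (norm_nonneg w) (norm_nonneg (Fin.tail z))]
    simp only [Function.comp_apply] at hqz
    rw [hqz, Polynomial.eval_eq_sum_lagrangeNode hq]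
    refine Finset.sum_congr rfl fun j _ => ?_
    rw [← hqz, hp]

/-- A holomorphic function of polynomial growth on the complement of the origin in `ℂ^(m+1)`,
`m ≥ 1`, is a polynomial. -/
theorem exists_mvPolynomial_of_growth_punctured {m : ℕ} (hm : 1 ≤ m) {h : (Fin (m + 1) → ℂ) → ℂ}
    (hd : ∀ z, z ≠ 0 → DifferentiableAt ℂ h z) {C : ℝ} {N : ℕ}
    (hb : ∀ z, 1 ≤ ‖z‖ → ‖h z‖ ≤ C * ‖z‖ ^ N) :
    ∃ p : MvPolynomial (Fin (m + 1)) ℂ, ∀ z, z ≠ 0 → h z = MvPolynomial.eval z p := by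
  have : Nonempty (Fin m) := ⟨⟨0, hm⟩⟩
  have hC : 0 ≤ C := by simpa using (norm_nonneg _).trans (hb (fun _ => 1) (by simp))
  -- These hyperplanes miss the origin, so the slices are entire; their points have norm at least 1,
  -- so the growth bound applies everywhere on them.
  have hslice : ∀ j : ℕ, ∃ p : MvPolynomial (Fin m) ℂ, ∀ z : Fin m → ℂ,
      h (Fin.cons ((j : ℂ) + 1) z) = MvPolynomial.eval z p := by
    intro j
    have hj : ‖(j : ℂ) + 1‖ = j + 1 := by exact_mod_cast Complex.norm_natCast (j + 1)
    refine exists_mvPolynomial_of_growth (g := fun z => h (Fin.cons ((j : ℂ) + 1) z))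
      (N := N) (C := C * ((j : ℝ) + 1) ^ N) (fun z => ?_) fun z => ?_
    · refine DifferentiableAt.comp z (hd _ fun h0 => ?_) (differentiable_cons_right _ z)
      have := congrFun h0 0
      simp only [Fin.cons_zero, Pi.zero_apply] at this
      exact Nat.cast_add_one_ne_zero j this
    · have h1 := norm_le_norm_cons ((j : ℂ) + 1) z
      rw [hj] at h1
      refine (hb _ (by linarith [(Nat.cast_nonneg j : (0 : ℝ) ≤ j)])).trans ?_
      rw [mul_assoc, ← mul_pow]
      have h2 := norm_cons_le ((j : ℂ) + 1) z
      rw [hj] at h2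
      gcongr
      nlinarith [mul_nonneg (Nat.cast_nonneg j : (0 : ℝ) ≤ j) (norm_nonneg z)]
  choose p hp using hslice
  -- For `z ≠ 0` the whole line `w ↦ (w, z)` misses the origin. The growth bound may fail for `‖w‖ ≤
  -- 1`, where compactness supplies `B`.
  have hgen : ∀ (w : ℂ) (z : Fin m → ℂ), z ≠ 0 → h (Fin.cons w z) =
      MvPolynomial.eval (Fin.cons w z) (MvPolynomial.interpolateHyperplanes N p) := by
    intro w z hz
    have hne : ∀ w : ℂ, (Fin.cons w z : Fin (m + 1) → ℂ) ≠ 0 := fun w h0 => hz <| by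
      funext i
      simpa using congrFun h0 i.succ
    have hdw : Differentiable ℂ fun w : ℂ => h (Fin.cons w z) := fun w =>
      DifferentiableAt.comp w (hd _ (hne w)) (differentiable_cons_left z w)
    obtain ⟨B, hB⟩ := (isCompact_closedBall (0 : ℂ) 1).exists_bound_of_continuousOn
      hdw.continuous.continuousOn
    obtain ⟨q, hq, hqz⟩ := Complex.exists_polynomial_of_growth hdw
      (C := max (C * (1 + ‖z‖) ^ N) B) (N := N) fun w => by
        rcases le_or_gt ‖w‖ 1 with hw | hw
        · have h2 := (hB w (by simpa using hw)).trans (le_max_right (C * (1 + ‖z‖) ^ N) B)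
          exact h2.trans (le_mul_of_one_le_right ((norm_nonneg _).trans h2)
            (one_le_pow₀ (by linarith [norm_nonneg w])))
        · refine (hb _ (hw.le.trans (norm_le_norm_cons w z))).trans ?_
          refine le_trans ?_ (mul_le_mul_of_nonneg_right (le_max_left _ _) (by positivity))
          rw [mul_assoc, ← mul_pow]
          gcongr
          nlinarith [norm_cons_le w z, norm_nonneg w, norm_nonneg z,
            mul_nonneg (norm_nonneg w) (norm_nonneg z)]
    rw [MvPolynomial.eval_interpolateHyperplanes, hqz, Polynomial.eval_eq_sum_lagrangeNode hq]
    refine Finset.sum_congr rfl fun j _ => ?_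
    rw [← hqz, hp]
  refine ⟨MvPolynomial.interpolateHyperplanes N p, fun z hz => ?_⟩
  -- A point of the `z₀`-axis other than the origin is the limit of the points `(z 0, t, …, t)` off
  -- the axis, and both sides are continuous there.
  by_cases hz' : Fin.tail z = 0
  · have hc : Continuous fun t : ℂ => (Fin.cons (z 0) (fun _ => t) : Fin (m + 1) → ℂ) :=
      continuous_pi fun i => by
        refine Fin.cases ?_ (fun j => ?_) i
        · simpa using continuous_const
        · simpa using continuous_id'
    have h0 : (Fin.cons (z 0) (fun _ => (0 : ℂ)) : Fin (m + 1) → ℂ) = z := by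
      rw [← Fin.cons_self_tail z, hz']; rfl
    have h1 : Filter.Tendsto (fun t : ℂ => (Fin.cons (z 0) (fun _ => t) : Fin (m + 1) → ℂ))
        (𝓝[≠] 0) (𝓝 z) := by
      conv => enter [3]; rw [← h0]
      exact (hc.tendsto 0).mono_left nhdsWithin_le_nhds
    have h2 := ((hd z hz).continuousAt.tendsto).comp h1
    have h3 := ((MvPolynomial.continuous_eval
      (MvPolynomial.interpolateHyperplanes N p)).tendsto z).comp h1
    refine tendsto_nhds_unique h2 (h3.congr' ?_)
    filter_upwards [self_mem_nhdsWithin] with t ht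
    exact (hgen _ _ fun h0 => ht (by simpa using congrFun h0 ⟨0, hm⟩)).symm
  · rw [← Fin.cons_self_tail z]
    exact hgen _ _ hz'

/-! ### Functions that the contraction multiplies by a constant -/

namespace DiagonalContraction

variable {n : ℕ} (μ : DiagonalContraction n)

/-- A continuous function on `ℂⁿ ∖ {0}` that the contraction multiplies by a constant has
polynomial growth. -/
theorem exists_growth_of_equivariant [Nonempty (Fin n)] {c : ℂ} (hc : c ≠ 0)
    {h : (Fin n → ℂ) → ℂ} (hcont : ∀ z, z ≠ 0 → ContinuousAt h z)
    (heq : ∀ z, z ≠ 0 → h (fun i => μ.mult i * z i) = c * h z) :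
    ∃ (C : ℝ) (N : ℕ), ∀ z, 1 ≤ ‖z‖ → ‖h z‖ ≤ C * ‖z‖ ^ N := by
  obtain ⟨i₀, hi₀⟩ := Finite.exists_min fun i => ‖μ.mult i‖
  obtain ⟨i₁, hi₁⟩ := Finite.exists_max fun i => ‖μ.mult i‖
  set m := ‖μ.mult i₀‖
  set M := ‖μ.mult i₁‖
  have hm0 : 0 < m := μ.norm_pos i₀
  have hm1 : m < 1 := μ.norm_lt_one i₀
  have hM0 : 0 < M := μ.norm_pos i₁
  have hM1 : M < 1 := μ.norm_lt_one i₁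
  have hlow : ∀ z : Fin n → ℂ, m * ‖z‖ ≤ ‖fun i => μ.mult i * z i‖ := by
    intro z
    rw [mul_comm, ← le_div_iff₀ hm0, pi_norm_le_iff_of_nonneg (by positivity)]
    intro i
    rw [le_div_iff₀ hm0, mul_comm]
    calc m * ‖z i‖ ≤ ‖μ.mult i‖ * ‖z i‖ := by gcongr; exact hi₀ i
      _ = ‖μ.mult i * z i‖ := (norm_mul _ _).symm
      _ ≤ _ := norm_le_pi_norm (fun i => μ.mult i * z i) i
  have hup : ∀ z : Fin n → ℂ, ‖fun i => μ.mult i * z i‖ ≤ M * ‖z‖ := by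
    intro z
    rw [pi_norm_le_iff_of_nonneg (by positivity)]
    intro i
    rw [norm_mul]
    gcongr
    · exact hi₁ i
    · exact norm_le_pi_norm z i
  -- With this `N`, one application of the contraction shrinks `‖z‖ ^ N` at least by the factor
  -- `‖c‖`.
  obtain ⟨N, hN⟩ : ∃ N : ℕ, M ^ N < ‖c‖ := exists_pow_lt_of_lt_one (norm_pos_iff.mpr hc) hM1
  -- The contraction shrinks norms at most by the factor `m`, so an orbit that enters the unit ball
  -- from outside cannot jump over this annulus.
  have hK : IsCompact (Metric.closedBall (0 : Fin n → ℂ) 1 ∩ {z | m ≤ ‖z‖}) :=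
    (isCompact_closedBall _ _).inter_right (isClosed_le continuous_const continuous_norm)
  obtain ⟨B, hB⟩ := hK.exists_bound_of_continuousOn (f := h) fun z hz =>
    (hcont z (norm_pos_iff.mp (hm0.trans_le hz.2))).continuousWithinAt
  have hBC : ∀ z : Fin n → ℂ, m ≤ ‖z‖ → ‖z‖ ≤ 1 → ‖h z‖ ≤ (max B 0 / m ^ N) * ‖z‖ ^ N := by
    intro z h1 h2
    rw [div_mul_eq_mul_div, le_div_iff₀ (by positivity)]
    have := (hB z ⟨by simpa using h2, h1⟩).trans (le_max_left B 0)
    gcongr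
  refine ⟨max B 0 / m ^ N, N, ?_⟩
  -- Here `k` bounds the number of applications that bring `z` into the unit ball. The bound at `f
  -- z` gives the one at `z`, since `h (f z) = c * h z` and `‖f z‖ ^ N ≤ ‖c‖ * ‖z‖ ^ N`.
  have key : ∀ (k : ℕ) (z : Fin n → ℂ), m ≤ ‖z‖ → M ^ k * ‖z‖ ≤ 1 →
      ‖h z‖ ≤ (max B 0 / m ^ N) * ‖z‖ ^ N := by
    intro k
    induction k with
    | zero => intro z h1 h2; exact hBC z h1 (by simpa using h2)
    | succ k ih =>
      intro z h1 h2
      rcases le_or_gt ‖z‖ 1 with hz | hz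
      · exact hBC z h1 hz
      have hz0 : z ≠ 0 := norm_pos_iff.mp (by linarith)
      have h3 := ih (fun i => μ.mult i * z i) ((le_mul_of_one_le_right hm0.le hz.le).trans (hlow z))
        (by
          calc M ^ k * ‖fun i => μ.mult i * z i‖ ≤ M ^ k * (M * ‖z‖) := by gcongr; exact hup z
            _ = M ^ (k + 1) * ‖z‖ := by ring
            _ ≤ 1 := h2)
      rw [heq z hz0, norm_mul] at h3
      have h4 : (max B 0 / m ^ N) * ‖fun i => μ.mult i * z i‖ ^ N ≤
          ‖c‖ * ((max B 0 / m ^ N) * ‖z‖ ^ N) := by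
        calc (max B 0 / m ^ N) * ‖fun i => μ.mult i * z i‖ ^ N
            ≤ (max B 0 / m ^ N) * (M * ‖z‖) ^ N := by gcongr; exact hup z
          _ = M ^ N * ((max B 0 / m ^ N) * ‖z‖ ^ N) := by ring
          _ ≤ _ := by gcongr
      exact le_of_mul_le_mul_left (h3.trans h4) (norm_pos_iff.mpr hc)
  intro z hz
  obtain ⟨k, hk⟩ : ∃ k : ℕ, M ^ k < ‖z‖⁻¹ :=
    exists_pow_lt_of_lt_one (inv_pos.mpr (by linarith)) hM1
  refine key k z (by linarith) ?_
  rw [← le_div_iff₀ (by linarith), one_div]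
  exact hk.le

/-- The factor by which the contraction multiplies the monomial `z ^ α`. -/
noncomputable def character (α : Fin n →₀ ℕ) : ℂ := ∏ i, μ.mult i ^ α i

theorem character_add (α β : Fin n →₀ ℕ) :
    μ.character (α + β) = μ.character α * μ.character β := by
  simp [character, pow_add, Finset.prod_mul_distrib]

@[simp] theorem character_zero : μ.character 0 = 1 := by simp [character]

@[simp] theorem character_single (i : Fin n) (k : ℕ) :
    μ.character (Finsupp.single i k) = μ.mult i ^ k := by
  rw [character, Finset.prod_eq_single i]
  · simp
  · intro j _ hj
    simp [hj.symm]
  · simp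

theorem coeff_aeval_scale (a : Fin n → ℂ) (p : MvPolynomial (Fin n) ℂ) (α : Fin n →₀ ℕ) :
    (MvPolynomial.aeval (fun i => MvPolynomial.C (a i) * MvPolynomial.X i) p).coeff α =
      (∏ i, a i ^ α i) * p.coeff α := by
  induction p using MvPolynomial.induction_on' with
  | monomial β c =>
    have : MvPolynomial.aeval (fun i => MvPolynomial.C (a i) * MvPolynomial.X i)
        (MvPolynomial.monomial β c) = MvPolynomial.monomial β ((∏ i, a i ^ β i) * c) := by
      rw [MvPolynomial.aeval_monomial, MvPolynomial.monomial_eq,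
        Finsupp.prod_fintype _ _ (by simp), Finsupp.prod_fintype _ _ (by simp)]
      simp only [mul_pow, Finset.prod_mul_distrib, MvPolynomial.algebraMap_eq, map_mul, map_prod,
        map_pow]
      ring
    rw [this, MvPolynomial.coeff_monomial, MvPolynomial.coeff_monomial]
    split_ifs with h
    · rw [h]
    · simp
  | add p q hp hq => rw [map_add, MvPolynomial.coeff_add, hp, hq, MvPolynomial.coeff_add, mul_add]

/-- Monomials are eigenvectors of the substitution `z_i ↦ μ_i z_i`, so only those with eigenvalue
`c` can occur. -/
theorem character_eq_of_coeff_ne_zero [Nonempty (Fin n)] {c : ℂ} {p : MvPolynomial (Fin n) ℂ}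
    (hp : ∀ z : Fin n → ℂ, z ≠ 0 → MvPolynomial.eval (fun i => μ.mult i * z i) p =
      c * MvPolynomial.eval z p) {α : Fin n →₀ ℕ} (hα : p.coeff α ≠ 0) : μ.character α = c := by
  have h : MvPolynomial.aeval (fun i => MvPolynomial.C (μ.mult i) * MvPolynomial.X i) p =
      MvPolynomial.C c * p := by
    -- The values are compared only where no coordinate vanishes: a product of infinite sets is
    -- enough, and it avoids the origin.
    refine MvPolynomial.funext_set (s := fun _ => {0}ᶜ)
      (fun _ => (Set.finite_singleton (0 : ℂ)).infinite_compl) fun z hz => ?_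
    have hz0 : z ≠ 0 := fun h0 => hz (Classical.arbitrary _) (Set.mem_univ _) (by simp [h0])
    rw [map_mul, MvPolynomial.eval_C, ← hp z hz0, MvPolynomial.aeval_def,
      MvPolynomial.algebraMap_eq,
      MvPolynomial.eval_eval₂]
    simp only [map_mul, MvPolynomial.eval_C, MvPolynomial.eval_X]
    have : (MvPolynomial.eval z).comp MvPolynomial.C = RingHom.id ℂ := by ext x; simp
    rw [this]; rfl
  have h1 := congrArg (MvPolynomial.coeff α) h
  rw [coeff_aeval_scale, MvPolynomial.coeff_C_mul] at h1
  exact mul_right_cancel₀ hα h1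

/-- Holomorphic functions on `ℂⁿ ∖ {0}`, `n ≥ 2`, that the contraction multiplies by a constant are
polynomials. -/
theorem exists_mvPolynomial_of_equivariant (hn : 2 ≤ n) {c : ℂ} (hc : c ≠ 0)
    {h : (Fin n → ℂ) → ℂ} (hd : ∀ z, z ≠ 0 → DifferentiableAt ℂ h z)
    (heq : ∀ z, z ≠ 0 → h (fun i => μ.mult i * z i) = c * h z) :
    ∃ p : MvPolynomial (Fin n) ℂ, (∀ z, z ≠ 0 → h z = MvPolynomial.eval z p) ∧
      ∀ α, p.coeff α ≠ 0 → μ.character α = c := by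
  obtain ⟨m, rfl⟩ : ∃ m, n = m + 1 := ⟨n - 1, by omega⟩
  obtain ⟨C, N, hb⟩ := μ.exists_growth_of_equivariant hc (fun z hz => (hd z hz).continuousAt) heq
  obtain ⟨p, hp⟩ := exists_mvPolynomial_of_growth_punctured (by omega) hd hb
  refine ⟨p, hp, fun α => μ.character_eq_of_coeff_ne_zero fun z hz => ?_⟩
  rw [← hp z hz, ← heq z hz, hp]
  intro h0
  refine hz (funext fun i => ?_)
  have := congrFun h0 i
  simpa [μ.mult_ne_zero i] using this

/-! ### Arithmetic of multipliers without relations -/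

variable {μ}

/-- Cancelling the common factor with exponents `min (α i) (β i)` leaves a relation between disjoint
sets of indices, which must be trivial. -/
theorem NoRelation.eq_of_character_eq {S : Finset (Fin n)} (hS : μ.NoRelation S)
    {α β : Fin n →₀ ℕ} (hα : ∀ i, i ∉ S → α i = 0) (hβ : ∀ i, i ∉ S → β i = 0)
    (h : μ.character α = μ.character β) : α = β := by
  classical
  have hprod : ∀ γ : Fin n →₀ ℕ, (∀ i, i ∉ S → γ i = 0) →
      μ.character γ = ∏ i ∈ S, μ.mult i ^ γ i := fun γ hγ =>
    (Finset.prod_subset (Finset.subset_univ S) fun i _ hi => by simp [hγ i hi]).symm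
  rw [hprod α hα, hprod β hβ] at h
  have h0 : ∏ i ∈ S, μ.mult i ^ min (α i) (β i) ≠ 0 :=
    Finset.prod_ne_zero_iff.mpr fun i _ => pow_ne_zero _ (μ.mult_ne_zero i)
  have hsub : ∏ i ∈ S, μ.mult i ^ (α i - β i) = ∏ i ∈ S, μ.mult i ^ (β i - α i) := by
    refine mul_right_cancel₀ h0 ?_
    rw [← Finset.prod_mul_distrib, ← Finset.prod_mul_distrib]
    convert h using 2 with i _ i _
    · rw [← pow_add]; congr 1; omega
    · rw [← pow_add]; congr 1; omega
  -- With truncated subtraction the exponent is `|α i - β i|`: one of the two summands is always 0.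
  have key := hS (S.filter fun i => β i ≤ α i) (S.filter fun i => ¬ β i ≤ α i)
    (Finset.disjoint_filter_filter_not _ _ _) (Finset.filter_union_filter_not_eq _ _)
    (fun i => (α i - β i) + (β i - α i)) (by
      have e1 : ∏ i ∈ S.filter (fun i => β i ≤ α i), μ.mult i ^ (α i - β i + (β i - α i)) =
          ∏ i ∈ S, μ.mult i ^ (α i - β i) := by
        rw [Finset.prod_filter]
        refine Finset.prod_congr rfl fun i _ => ?_
        split_ifs with hi
        · rw [Nat.sub_eq_zero_of_le hi, add_zero]
        · rw [Nat.sub_eq_zero_of_le (by omega), pow_zero]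
      have e2 : ∏ i ∈ S.filter (fun i => ¬ β i ≤ α i), μ.mult i ^ (α i - β i + (β i - α i)) =
          ∏ i ∈ S, μ.mult i ^ (β i - α i) := by
        rw [Finset.prod_filter]
        refine Finset.prod_congr rfl fun i _ => ?_
        rw [ite_not]
        split_ifs with hi
        · rw [Nat.sub_eq_zero_of_le hi, pow_zero]
        · rw [Nat.sub_eq_zero_of_le (by omega : α i ≤ β i), zero_add]
      rw [e1, e2, hsub])
  ext i
  by_cases hi : i ∈ S
  · have := key i hi
    omega
  · rw [hα i hi, hβ i hi]

/-- `τ` sends every index to a representative in `S` with the same multiplier, and there is no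
relation between the multipliers of the representatives. -/
structure IsReduction (μ : DiagonalContraction n) (τ : Fin n → Fin n) : Prop where
  mult_eq : ∀ i, μ.mult (τ i) = μ.mult i
  noRelation : μ.NoRelation (Finset.univ.image τ)

theorem character_mapDomain {τ : Fin n → Fin n} (hτ : ∀ i, μ.mult (τ i) = μ.mult i)
    (α : Fin n →₀ ℕ) : μ.character (α.mapDomain τ) = μ.character α := by
  induction α using Finsupp.induction_linear with
  | zero => simp
  | add α β hα hβ => rw [Finsupp.mapDomain_add, character_add, character_add, hα, hβ]
  | single i k => rw [Finsupp.mapDomain_single, character_single, character_single, hτ]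

namespace IsReduction

variable {τ : Fin n → Fin n} (hτ : μ.IsReduction τ)
include hτ

/-- Adding up the exponents over each class of `τ` keeps the character and moves the exponents to
the representatives, which satisfy no relation. -/
theorem mapDomain_eq {α β : Fin n →₀ ℕ} (h : μ.character α = μ.character β) :
    α.mapDomain τ = β.mapDomain τ := by
  refine hτ.noRelation.eq_of_character_eq ?_ ?_ ?_
  · intro i hi
    exact Finsupp.mapDomain_of_notMem_range _ _ fun ⟨j, hj⟩ => hi (by simp [← hj])
  · intro i hi
    exact Finsupp.mapDomain_of_notMem_range _ _ fun ⟨j, hj⟩ => hi (by simp [← hj])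
  · rw [character_mapDomain hτ.mult_eq, character_mapDomain hτ.mult_eq, h]

/-- Passing to classes preserves the total degree, so `α` has degree 1. Only the class of its
variable is determined. -/
theorem exists_single_of_character_eq {α : Fin n →₀ ℕ} {i : Fin n}
    (h : μ.character α = μ.mult i) : ∃ l, τ l = τ i ∧ α = Finsupp.single l 1 := by
  have h1 : α.mapDomain τ = Finsupp.single (τ i) 1 := by
    rw [← Finsupp.mapDomain_single]
    exact hτ.mapDomain_eq (by simpa using h)
  obtain ⟨l, hl⟩ : ∃ l, α l ≠ 0 := by
    by_contra! h0
    have : α = 0 := Finsupp.ext h0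
    simp [this] at h1
    simpa using h1.symm
  obtain ⟨β, rfl⟩ : ∃ β, α = Finsupp.single l 1 + β :=
    ⟨α - Finsupp.single l 1, by
      rw [add_tsub_cancel_of_le]
      rw [Finsupp.single_le_iff]; omega⟩
  rw [Finsupp.mapDomain_add, Finsupp.mapDomain_single] at h1
  have h2 := congrArg Finsupp.degree h1
  simp only [map_add, Finsupp.degree_single, Finsupp.degree_mapDomain] at h2
  have hβ : β = 0 := (Finsupp.degree_eq_zero_iff _).mp (by omega)
  subst hβ
  refine ⟨l, ?_, by simp⟩
  simpa [Finsupp.single_left_inj] using h1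

theorem eq_zero_of_mult_mul_character_eq {α : Fin n →₀ ℕ} {s i : Fin n}
    (h : μ.mult s * μ.character α = μ.mult i) : α = 0 ∧ τ s = τ i := by
  obtain ⟨l, hl, h1⟩ := hτ.exists_single_of_character_eq (α := Finsupp.single s 1 + α) (i := i)
    (by rw [character_add, character_single, pow_one, h])
  have h2 := congrArg Finsupp.degree h1
  simp only [map_add, Finsupp.degree_single] at h2
  have hα : α = 0 := (Finsupp.degree_eq_zero_iff _).mp (by omega)
  subst hα
  refine ⟨rfl, ?_⟩
  rw [add_zero, Finsupp.single_left_inj one_ne_zero] at h1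
  rw [h1, hl]

/-- If an exponent `k` is 0, then `b` is a multiplier. Otherwise eliminating `b` gives `μ_i μ_j' ^
k' = μ_i' μ_j ^ k`. The class of `j` has exponent at most 1 on the left and at least `k ≥ 1` on the
right; hence `k = 1` and `μ_i = μ_j`, so `b = 1`. -/
theorem eq_one_or_eq_mult {b : ℂ} (hb : ∀ j, ∃ i, ∃ k : ℕ, b * μ.mult j ^ k = μ.mult i)
    {j j' : Fin n} (hj : τ j ≠ τ j') : b = 1 ∨ ∃ i, b = μ.mult i := by
  obtain ⟨i, k, h⟩ := hb j
  obtain ⟨i', k', h'⟩ := hb j'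
  rcases Nat.eq_zero_or_pos k with rfl | hk
  · exact Or.inr ⟨i, by simpa using h⟩
  rcases Nat.eq_zero_or_pos k' with rfl | hk'
  · exact Or.inr ⟨i', by simpa using h'⟩
  have h1 : μ.character (Finsupp.single i 1 + Finsupp.single j' k') =
      μ.character (Finsupp.single i' 1 + Finsupp.single j k) := by
    simp only [character_add, character_single, pow_one]
    rw [← h, ← h']; ring
  have h2 := hτ.mapDomain_eq h1
  simp only [Finsupp.mapDomain_add, Finsupp.mapDomain_single] at h2
  have h3 := DFunLike.congr_fun h2 (τ j)
  simp only [Finsupp.add_apply, Finsupp.single_apply, if_neg hj.symm, if_true, add_zero] at h3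
  have hk1 : k = 1 ∧ τ i = τ j := by
    split_ifs at h3 with h4 <;> omega
  left
  have h4 : μ.mult i = μ.mult j := by rw [← hτ.mult_eq i, hk1.2, hτ.mult_eq]
  rw [hk1.1, pow_one, h4] at h
  exact mul_eq_right₀ (μ.mult_ne_zero j) |>.mp h

end IsReduction

/-- The data of a system of polynomial coefficients `p i` of a vector field without zeros on
`ℂⁿ ∖ {0}` that the contraction multiplies by `b`. -/
structure IsSemiInvariant (μ : DiagonalContraction n) (b : ℂ)
    (p : Fin n → MvPolynomial (Fin n) ℂ) : Prop where
  character_eq : ∀ i α, (p i).coeff α ≠ 0 → b * μ.character α = μ.mult i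
  exists_ne_zero : ∀ z : Fin n → ℂ, z ≠ 0 → ∃ i, MvPolynomial.eval z (p i) ≠ 0

/-! ### Which monomials occur in the lifted vector field -/

namespace IsSemiInvariant

variable {b : ℂ} {p : Fin n → MvPolynomial (Fin n) ℂ} (hp : μ.IsSemiInvariant b p)
include hp

/-- At the basis vector `e_j` every monomial except the powers of `z_j` vanishes, while the field
does not. -/
theorem exists_mul_pow_eq (j : Fin n) : ∃ i, ∃ k : ℕ, b * μ.mult j ^ k = μ.mult i := by
  obtain ⟨i, hi⟩ := hp.exists_ne_zero (Pi.single j 1) (by simp)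
  rw [MvPolynomial.eval_eq] at hi
  obtain ⟨α, hα, h⟩ := Finset.exists_ne_zero_of_sum_ne_zero hi
  refine ⟨i, α j, ?_⟩
  have h1 : α = Finsupp.single j (α j) := by
    ext l
    by_cases hl : j = l
    · simp [hl]
    · rw [Finsupp.single_apply, if_neg hl]
      by_contra h0
      refine h ?_
      have : ∏ i ∈ α.support, (Pi.single j 1 : Fin n → ℂ) i ^ α i = 0 :=
        Finset.prod_eq_zero (i := l) (by simpa using h0) (by
          rw [Pi.single_eq_of_ne (Ne.symm hl), zero_pow h0])
      rw [this, mul_zero]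
  rw [← character_single, ← h1]
  exact hp.character_eq i α (by simpa using hα)

theorem eval_eq_sum_of_one {τ : Fin n → Fin n} (hτ : μ.IsReduction τ) (hb : b = 1)
    (z : Fin n → ℂ) (i : Fin n) : MvPolynomial.eval z (p i) =
      ∑ l with τ l = τ i, (p i).coeff (Finsupp.single l 1) * z l := by
  classical
  rw [MvPolynomial.eval_eq']
  have hinj : Set.InjOn (fun l : Fin n => Finsupp.single l 1)
      (Finset.univ.filter fun l => τ l = τ i : Finset (Fin n)) :=
    fun l _ l' _ h => (Finsupp.single_left_inj one_ne_zero).mp h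
  have hsub : (p i).support ⊆
      (Finset.univ.filter fun l => τ l = τ i).image fun l : Fin n => Finsupp.single l 1 := by
    intro α hα
    obtain ⟨l, hl, rfl⟩ := hτ.exists_single_of_character_eq (α := α) (i := i) (by
      simpa [hb] using hp.character_eq i α (by simpa using hα))
    simp only [Finset.mem_image, Finset.mem_filter, Finset.mem_univ, true_and]
    exact ⟨l, hl, rfl⟩
  rw [Finset.sum_subset hsub (fun α _ hα => by
    rw [MvPolynomial.notMem_support_iff.mp hα, zero_mul]), Finset.sum_image hinj]
  refine Finset.sum_congr rfl fun l _ => ?_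
  congr 1
  rw [Finset.prod_eq_single l]
  · simp
  · intro j _ hj
    simp [hj.symm]
  · simp

/-- The condition reads `μ_s μ ^ α = μ_i`; the factor `μ_s` already uses up the degree 1 of the
right-hand side. -/
theorem coeff_eq_zero_of_mult {τ : Fin n → Fin n} (hτ : μ.IsReduction τ) {s : Fin n}
    (hb : b = μ.mult s) {i : Fin n} {α : Fin n →₀ ℕ} (h : (p i).coeff α ≠ 0) :
    α = 0 ∧ τ s = τ i :=
  hτ.eq_zero_of_mult_mul_character_eq (hb ▸ hp.character_eq i α h)

theorem eq_C_of_mult {τ : Fin n → Fin n} (hτ : μ.IsReduction τ) {s : Fin n}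
    (hb : b = μ.mult s) (i : Fin n) : p i = MvPolynomial.C ((p i).coeff 0) := by
  ext α
  rw [MvPolynomial.coeff_C]
  split_ifs with h
  · rw [h]
  · by_contra h0
    exact h (hp.coeff_eq_zero_of_mult hτ hb h0).1.symm

theorem coeff_zero_eq_zero_of_mult {τ : Fin n → Fin n} (hτ : μ.IsReduction τ) {s : Fin n}
    (hb : b = μ.mult s) {i : Fin n} (hi : τ i ≠ τ s) : (p i).coeff 0 = 0 := by
  by_contra h0
  exact hi (hp.coeff_eq_zero_of_mult hτ hb h0).2.symm

theorem exists_coeff_zero_ne_zero_of_mult [Nonempty (Fin n)] {τ : Fin n → Fin n}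
    (hτ : μ.IsReduction τ) {s : Fin n} (hb : b = μ.mult s) : ∃ i, (p i).coeff 0 ≠ 0 := by
  obtain ⟨i, hi⟩ := hp.exists_ne_zero (Pi.single s 1) (by simp)
  refine ⟨i, ?_⟩
  rwa [hp.eq_C_of_mult hτ hb i, MvPolynomial.eval_C] at hi

/-- Here the character of `α` is `a ^ |α|`, and `b * a ^ d = a` determines `d` because `0 < ‖a‖ <
1`. -/
theorem exists_isHomogeneous [Nonempty (Fin n)] {a : ℂ} (ha : μ.IsClassical a) :
    ∃ d : ℕ, b * a ^ d = a ∧ ∀ i, (p i).IsHomogeneous d := by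
  have hchar : ∀ α : Fin n →₀ ℕ, μ.character α = a ^ α.degree := by
    intro α
    rw [character, Finsupp.degree_eq_sum, ← Finset.prod_pow_eq_pow_sum]
    exact Finset.prod_congr rfl fun i _ => by rw [ha i]
  have hmem : ∀ i α, (p i).coeff α ≠ 0 → b * a ^ α.degree = a := by
    intro i α h
    have := hp.character_eq i α h
    rwa [hchar, ha i] at this
  let j : Fin n := Classical.arbitrary _
  obtain ⟨i, hi⟩ := hp.exists_ne_zero (Pi.single j 1) (by simp)
  rw [MvPolynomial.eval_eq] at hi
  obtain ⟨α, hα, -⟩ := Finset.exists_ne_zero_of_sum_ne_zero hi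
  have hd := hmem i α (by simpa using hα)
  refine ⟨α.degree, hd, fun l β hβ => ?_⟩
  have ha0 : a ≠ 0 := ha j ▸ μ.mult_ne_zero j
  have hb0 : b ≠ 0 := by
    rintro rfl
    exact ha0 (by simpa using hd.symm)
  have h1 := congrArg norm (mul_left_cancel₀ hb0 ((hmem l β hβ).trans hd.symm))
  rw [norm_pow, norm_pow] at h1
  have h2 : ‖a‖ < 1 := ha j ▸ μ.norm_lt_one j
  rw [show Finsupp.weight 1 β = β.degree from
    (DFunLike.congr_fun Finsupp.degree_eq_weight_one β).symm]
  exact pow_right_injective₀ (norm_pos_iff.mpr ha0) h2.ne h1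

end IsSemiInvariant

end DiagonalContraction

/-! ### The quotient map and its derivative in charts -/

/-- Differentiability of a map into a tangent bundle is tested in a trivialization; this makes its
fibre coordinate computable by the chain rule. -/
theorem TangentBundle.trivializationAt_apply_snd {M : Type*} [TopologicalSpace M]
    {H : Type*} [TopologicalSpace H] [ChartedSpace H M]
    {E : Type*} [NormedAddCommGroup E] [NormedSpace ℂ E] {I : ModelWithCorners ℂ E H}
    [IsManifold I 1 M] {x₀ x : M} (hx : x ∈ (chartAt H x₀).source) (v : TangentSpace I x) :
    (trivializationAt E (TangentSpace I) x₀ ⟨x, v⟩).2 =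
      mfderiv I 𝓘(ℂ, E) (extChartAt I x₀) x v := by
  have h := DFunLike.congr_fun (TangentBundle.continuousLinearMapAt_trivializationAt (I := I) hx) v
  refine Eq.trans ?_ h
  rw [Bundle.Trivialization.continuousLinearMapAt_apply, Bundle.Trivialization.linearMapAt_apply,
    if_pos]
  exact hx

section OrbitQuotient

variable {M : Type*} [TopologicalSpace M] {G : Type*} [Group G]
  [MulAction G M] [ProperlyDiscontinuousSMul G M] [ContinuousConstSMul G M] [IsCancelSMul G M]
  [T2Space M] [LocallyCompactSpace M]
  {H : Type*} [TopologicalSpace H] [ChartedSpace H M]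
  {E : Type*} [NormedAddCommGroup E] [NormedSpace ℂ E] (I : ModelWithCorners ℂ E H)

/-- In the charts of the orbit space, the quotient map is locally the action of one group element
followed by a chart. -/
theorem exists_extChartAt_orbitQuotient_eq (m₀ : M) : ∃ (g : G) (m₁ : M),
    g • m₀ ∈ (chartAt H m₁).source ∧
    ∀ᶠ m in 𝓝 m₀, extChartAt I (Quotient.mk (orbitRel G M) m₀ : orbitRel.Quotient G M)
      (Quotient.mk (orbitRel G M) m) = extChartAt I m₁ (g • m) := by
  obtain ⟨s, m₁, hs, hchart⟩ : ∃ (s : OpenPartialHomeomorph (orbitRel.Quotient G M) M) (m₁ : M),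
      (∀ y, s.symm y = (Quotient.mk (orbitRel G M) y : orbitRel.Quotient G M)) ∧
        chartAt H (Quotient.mk (orbitRel G M) m₀ : orbitRel.Quotient G M) =
          s.trans (chartAt H m₁) := by
    obtain ⟨q, hq⟩ := chart_mem_atlas H (Quotient.mk (orbitRel G M) m₀ : orbitRel.Quotient G M)
    exact ⟨_, _, fun y => congrFun (IsLocalHomeomorph.localInverseAt_symm _ _) y, hq.symm⟩
  have hsrc := mem_chart_source H (Quotient.mk (orbitRel G M) m₀ : orbitRel.Quotient G M)
  rw [hchart, OpenPartialHomeomorph.trans_source] at hsrc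
  have hq : (Quotient.mk (orbitRel G M) (s (Quotient.mk (orbitRel G M) m₀)) :
      orbitRel.Quotient G M) = Quotient.mk (orbitRel G M) m₀ := by
    rw [← hs]; exact s.left_inv hsrc.1
  obtain ⟨g, hg⟩ : ∃ g : G, g • m₀ = s (Quotient.mk (orbitRel G M) m₀) := Quotient.exact hq
  have hgt : g • m₀ ∈ s.target := hg ▸ s.map_source hsrc.1
  refine ⟨g, m₁, hg ▸ hsrc.2, ?_⟩
  filter_upwards [(continuous_const_smul g).continuousAt.preimage_mem_nhds
    (s.open_target.mem_nhds hgt)] with y hy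
  have h1 : (Quotient.mk (orbitRel G M) y : orbitRel.Quotient G M)
      = Quotient.mk (orbitRel G M) (g • y) := Quotient.sound (by exact ⟨g⁻¹, by simp⟩)
  have h2 : s (Quotient.mk (orbitRel G M) y) = g • y := by
    rw [h1, ← hs, s.right_inv hy]
  simp only [extChartAt_coe, hchart, OpenPartialHomeomorph.coe_trans, Function.comp_apply, h2]

theorem contMDiff_orbitQuotient_mk [IsManifold I ω M]
    (hG : ∀ g : G, ContMDiff I I ω (fun m : M => g • m)) :
    ContMDiff I I ω (fun m : M => (Quotient.mk (orbitRel G M) m : orbitRel.Quotient G M)) := by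
  intro m₀
  rw [contMDiffAt_iff_target]
  refine ⟨continuous_quot_mk.continuousAt, ?_⟩
  obtain ⟨g, m₁, hm₁, hev⟩ := exists_extChartAt_orbitQuotient_eq (G := G) I m₀
  have h1 : ContMDiffAt I 𝓘(ℂ, E) ω (extChartAt I m₁) (g • m₀) := contMDiffAt_extChartAt' hm₁
  have h2 : ContMDiffAt I 𝓘(ℂ, E) ω (fun m => extChartAt I m₁ (g • m)) m₀ :=
    ContMDiffAt.comp m₀ h1 (hG g m₀)
  exact h2.congr_of_eventuallyEq hev

end OrbitQuotient

theorem puncturedSpace.extChartAt_apply {n : ℕ} (w z : puncturedSpace n) :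
    extChartAt 𝓘(ℂ, Fin n → ℂ) w z = z.1 := rfl

/-- A map on `ℂⁿ ∖ {0}` that is the restriction of `φ` has the derivative of `φ`. -/
theorem puncturedSpace.hasMFDerivAt_of_eventuallyEq {n : ℕ} {E : Type*} [NormedAddCommGroup E]
    [NormedSpace ℂ E] {ψ : puncturedSpace n → E}
    {φ : (Fin n → ℂ) → E} {z : puncturedSpace n} {L : (Fin n → ℂ) →L[ℂ] E}
    (hφ : HasFDerivAt φ L z.1) (h : ∀ᶠ w in 𝓝 z, ψ w = φ w.1) :
    HasMFDerivAt 𝓘(ℂ, Fin n → ℂ) 𝓘(ℂ, E) ψ z L := by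
  have hval : HasMFDerivAt 𝓘(ℂ, Fin n → ℂ) 𝓘(ℂ, Fin n → ℂ)
      (Subtype.val : puncturedSpace n → Fin n → ℂ) z (ContinuousLinearMap.id ℂ (Fin n → ℂ)) := by
    refine ⟨continuous_subtype_val.continuousAt, ?_⟩
    refine HasFDerivWithinAt.congr_of_eventuallyEq (hasFDerivWithinAt_id _ _) ?_ ?_
    · refine nhdsWithin_le_nhds ?_
      filter_upwards [extChartAt_target_mem_nhds (I := 𝓘(ℂ, Fin n → ℂ)) z] with y hy
      exact (extChartAt 𝓘(ℂ, Fin n → ℂ) z).right_inv hy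
    · exact (extChartAt 𝓘(ℂ, Fin n → ℂ) z).right_inv
        (mem_extChartAt_target (I := 𝓘(ℂ, Fin n → ℂ)) z)
  exact (hφ.hasMFDerivAt.comp z hval).congr_of_eventuallyEq h

theorem puncturedSpace.differentiableAt_of_mdifferentiableAt {n : ℕ} {E : Type*}
    [NormedAddCommGroup E] [NormedSpace ℂ E] {ψ : puncturedSpace n → E}
    {φ : (Fin n → ℂ) → E} {z : puncturedSpace n}
    (hψ : MDifferentiableAt 𝓘(ℂ, Fin n → ℂ) 𝓘(ℂ, E) ψ z) (h : ∀ w : puncturedSpace n, φ w.1 = ψ w) :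
    DifferentiableAt ℂ φ z.1 := by
  have h2 := hψ.differentiableWithinAt_writtenInExtChartAt
  rw [ModelWithCorners.range_eq_univ, differentiableWithinAt_univ,
    puncturedSpace.extChartAt_apply] at h2
  simp only [writtenInExtChartAt, extChartAt_model_space_eq_id, PartialEquiv.refl_coe,
    Function.id_comp] at h2
  refine h2.congr_of_eventuallyEq ?_
  have h3 := extChartAt_target_mem_nhds (I := 𝓘(ℂ, Fin n → ℂ)) z
  rw [puncturedSpace.extChartAt_apply] at h3
  filter_upwards [h3] with y hy
  rw [Function.comp_apply, ← h]
  exact congrArg φ ((extChartAt 𝓘(ℂ, Fin n → ℂ) z).right_inv hy).symm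

/-! ### The derivative of the projection `π : W → X` -/

namespace DiagonalContraction

variable {n : ℕ} (μ : DiagonalContraction n)

/-- The linear map `z ↦ (μ₁ᵏ z₁, …, μₙᵏ zₙ)`. -/
noncomputable def powCLM (k : ℤ) : (Fin n → ℂ) →L[ℂ] (Fin n → ℂ) :=
  ContinuousLinearMap.pi fun i => (μ.mult i ^ k) • ContinuousLinearMap.proj i

@[simp] theorem powCLM_apply (k : ℤ) (v : Fin n → ℂ) (i : Fin n) :
    μ.powCLM k v i = μ.mult i ^ k * v i := rfl

theorem powCLM_neg_apply_apply (k : ℤ) (v : Fin n → ℂ) : μ.powCLM (-k) (μ.powCLM k v) = v := by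
  ext i
  simp [zpow_ne_zero k (μ.mult_ne_zero i)]

theorem coe_toPerm_zpow (k : ℤ) (z : puncturedSpace n) :
    ((μ.toPerm ^ k) z).1 = μ.powCLM k z.1 := by
  ext i
  exact μ.toPerm_zpow_apply k z i

theorem proj_toPerm (z : puncturedSpace n) : μ.proj (μ.toPerm z) = μ.proj z :=
  Quotient.sound (by exact ⟨⟨μ.toPerm, 1, by simp⟩, rfl⟩)

theorem contMDiff_proj :
    ContMDiff 𝓘(ℂ, Fin n → ℂ) 𝓘(ℂ, Fin n → ℂ) ω μ.proj :=
  contMDiff_orbitQuotient_mk _ (by rintro ⟨_, k, rfl⟩; exact μ.contMDiff_toPerm_zpow k)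

theorem mdifferentiableAt_proj (z : puncturedSpace n) :
    MDifferentiableAt 𝓘(ℂ, Fin n → ℂ) 𝓘(ℂ, Fin n → ℂ) μ.proj z :=
  (μ.contMDiff_proj z).mdifferentiableAt (by simp)

theorem contMDiff_lineBundle_mk (b : ℂˣ) :
    ContMDiff (𝓘(ℂ, Fin n → ℂ).prod 𝓘(ℂ, ℂ)) (𝓘(ℂ, Fin n → ℂ).prod 𝓘(ℂ, ℂ)) ω
      fun p : puncturedSpace n × ℂ => LineBundle.mk μ b p.1 p.2 :=
  contMDiff_orbitQuotient_mk _ (by rintro ⟨_, k, rfl⟩; exact μ.contMDiff_toPermLine_zpow b k)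

/-- The derivative of the projection `π : W → X` in the coordinates that Mathlib uses on the
tangent spaces. -/
noncomputable def dproj (z : puncturedSpace n) : (Fin n → ℂ) →L[ℂ] (Fin n → ℂ) :=
  mfderiv 𝓘(ℂ, Fin n → ℂ) 𝓘(ℂ, Fin n → ℂ) μ.proj z

theorem hasMFDerivAt_proj (z : puncturedSpace n) :
    HasMFDerivAt 𝓘(ℂ, Fin n → ℂ) 𝓘(ℂ, Fin n → ℂ) μ.proj z (μ.dproj z) :=
  (μ.mdifferentiableAt_proj z).hasMFDerivAt

theorem exists_extChartAt_proj_eq (z₀ : puncturedSpace n) : ∃ k : ℤ, ∀ᶠ z in 𝓝 z₀,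
    extChartAt 𝓘(ℂ, Fin n → ℂ) (μ.proj z₀) (μ.proj z) = μ.powCLM k z.1 := by
  obtain ⟨⟨_, k, rfl⟩, m₁, -, h⟩ := exists_extChartAt_orbitQuotient_eq
    (G := Subgroup.zpowers μ.toPerm) 𝓘(ℂ, Fin n → ℂ) z₀
  refine ⟨k, ?_⟩
  filter_upwards [h] with z hz
  exact hz.trans (μ.coe_toPerm_zpow k z)

/-- In the chart at `π z₀` the projection is a power `f ^ k`, because the local inverse behind the
chart may select another point of the orbit. As `f ^ k` is linear, the derivative is the same
invertible matrix at all points near `z₀`. -/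
theorem exists_mfderiv_extChartAt_dproj (z₀ : puncturedSpace n) : ∃ k : ℤ, ∀ᶠ z in 𝓝 z₀,
    μ.proj z ∈ (chartAt (Fin n → ℂ) (μ.proj z₀)).source ∧ ∀ v : Fin n → ℂ,
    mfderiv 𝓘(ℂ, Fin n → ℂ) 𝓘(ℂ, Fin n → ℂ) (extChartAt 𝓘(ℂ, Fin n → ℂ) (μ.proj z₀)) (μ.proj z)
      (μ.dproj z v) = μ.powCLM k v := by
  obtain ⟨k, hk⟩ := μ.exists_extChartAt_proj_eq z₀
  refine ⟨k, ?_⟩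
  filter_upwards [hk.eventually_nhds, μ.contMDiff_proj.continuous.continuousAt.preimage_mem_nhds
    ((chartAt (Fin n → ℂ) (μ.proj z₀)).open_source.mem_nhds (mem_chart_source _ (μ.proj z₀)))]
    with z hz hsrc
  refine ⟨hsrc, fun v => ?_⟩
  have h1 := puncturedSpace.hasMFDerivAt_of_eventuallyEq (μ.powCLM k).hasFDerivAt hz
  have h2 := (mdifferentiableAt_extChartAt (I := 𝓘(ℂ, Fin n → ℂ)) hsrc).hasMFDerivAt.comp z
    (μ.hasMFDerivAt_proj z)
  exact DFunLike.congr_fun (hasMFDerivAt_unique h2 h1) v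

theorem dproj_injective (z : puncturedSpace n) : Function.Injective (μ.dproj z) := by
  obtain ⟨k, hk⟩ := μ.exists_mfderiv_extChartAt_dproj z
  intro v w hvw
  have h := (hk.self_of_nhds).2
  have h1 := h v
  have h2 := h w
  rw [hvw] at h1
  rw [← μ.powCLM_neg_apply_apply k v, ← μ.powCLM_neg_apply_apply k w, ← h1, ← h2]

theorem dproj_surjective (z : puncturedSpace n) : Function.Surjective (μ.dproj z) :=
  LinearMap.surjective_of_injective (f := (μ.dproj z).toLinearMap) (μ.dproj_injective z)

/-- The chain rule for `π ∘ f = π`. The derivative of `f` is read off after composition with the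
inclusion `W → ℂⁿ`. -/
theorem dproj_toPerm (z : puncturedSpace n) (v : Fin n → ℂ) :
    μ.dproj (μ.toPerm z) (fun i => μ.mult i * v i) = μ.dproj z v := by
  have hf : MDifferentiableAt 𝓘(ℂ, Fin n → ℂ) 𝓘(ℂ, Fin n → ℂ) μ.toPerm z := by
    have := μ.contMDiff_toPerm_zpow 1
    rw [zpow_one] at this
    exact (this z).mdifferentiableAt (by simp)
  have h1 : HasMFDerivAt 𝓘(ℂ, Fin n → ℂ) 𝓘(ℂ, Fin n → ℂ)
      (fun w : puncturedSpace n => (μ.toPerm w).1) z (μ.powCLM 1) :=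
    puncturedSpace.hasMFDerivAt_of_eventuallyEq (φ := μ.powCLM 1) (μ.powCLM 1).hasFDerivAt
      (Filter.Eventually.of_forall fun w => by
        rw [← μ.coe_toPerm_zpow, zpow_one])
  have h2 : HasMFDerivAt 𝓘(ℂ, Fin n → ℂ) 𝓘(ℂ, Fin n → ℂ)
      (Subtype.val : puncturedSpace n → Fin n → ℂ) (μ.toPerm z)
      (ContinuousLinearMap.id ℂ (Fin n → ℂ)) :=
    puncturedSpace.hasMFDerivAt_of_eventuallyEq (φ := id) (hasFDerivAt_id _)
      (Filter.Eventually.of_forall fun w => rfl)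
  have h3 := hasMFDerivAt_unique (h2.comp z hf.hasMFDerivAt) h1
  have h4 : mfderiv 𝓘(ℂ, Fin n → ℂ) 𝓘(ℂ, Fin n → ℂ) μ.toPerm z v = fun i => μ.mult i * v i := by
    have h7 : μ.powCLM 1 v = fun i => μ.mult i * v i := funext fun i => by
      rw [powCLM_apply, zpow_one]
    exact (DFunLike.congr_fun h3 v).trans h7
  have h5 := (μ.hasMFDerivAt_proj (μ.toPerm z)).comp z hf.hasMFDerivAt
  have h6 : μ.proj ∘ μ.toPerm = μ.proj := funext μ.proj_toPerm
  rw [h6] at h5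
  rw [← h4]
  exact DFunLike.congr_fun (hasMFDerivAt_unique h5 (μ.hasMFDerivAt_proj z)) v

variable {μ} {b : ℂˣ}

theorem LineBundle.mk_toPerm_zpow (k : ℤ) (z : puncturedSpace n) (v : ℂ) :
    LineBundle.mk μ b ((μ.toPerm ^ k) z) ((b : ℂ) ^ k * v) = LineBundle.mk μ b z v :=
  Quotient.sound (by exact ⟨⟨μ.toPermLine b ^ k, k, rfl⟩, μ.toPermLine_zpow_apply b k (z, v)⟩)

theorem exists_toPerm_zpow_of_proj_eq {z w : puncturedSpace n} (h : μ.proj w = μ.proj z) :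
    ∃ k : ℤ, w = (μ.toPerm ^ k) z := by
  obtain ⟨⟨_, k, rfl⟩, hk⟩ := Quotient.exact h
  exact ⟨k, hk.symm⟩

/-! ### The lift of the foliation to a vector field on `W` -/

namespace Foliation

variable (F : μ.Foliation b)

/-- The lift of the morphism `L_b → TX` to a vector field on `W`. -/
theorem exists_lift : ∃ U : puncturedSpace n → Fin n → ℂ, (∀ z, U z ≠ 0) ∧
    ∀ z (c : ℂ), F.toFun (LineBundle.mk μ b z c) = ⟨μ.proj z, c • μ.dproj z (U z)⟩ := by
  have h : ∀ z, ∃ u : Fin n → ℂ, u ≠ 0 ∧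
      ∀ c : ℂ, F.toFun (LineBundle.mk μ b z c) = ⟨μ.proj z, c • μ.dproj z u⟩ := by
    intro z
    obtain ⟨A, hA, hF⟩ := F.fiberwise z
    obtain ⟨u, hu⟩ := μ.dproj_surjective z (A 1)
    refine ⟨u, ?_, fun c => ?_⟩
    · rintro rfl
      rw [map_zero] at hu
      exact one_ne_zero (hA (hu.symm.trans (map_zero A).symm))
    · rw [hF, hu]
      congr 1
      have := A.map_smul c 1
      rwa [smul_eq_mul, mul_one] at this
  choose U hU0 hU using h
  exact ⟨U, hU0, hU⟩

variable {F} {U : puncturedSpace n → Fin n → ℂ}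
  (hU : ∀ z (c : ℂ), F.toFun (LineBundle.mk μ b z c) = ⟨μ.proj z, c • μ.dproj z (U z)⟩)
include hU

/-- `[f z, b]` and `[z, 1]` are the same point of `L_b`. Their images agree in `TX`, and the
derivative of `π` is injective. -/
theorem lift_toPerm (z : puncturedSpace n) (i : Fin n) :
    (b : ℂ) * U (μ.toPerm z) i = μ.mult i * U z i := by
  have h1 : F.toFun (LineBundle.mk μ b (μ.toPerm z) b) = F.toFun (LineBundle.mk μ b z 1) := by
    have := LineBundle.mk_toPerm_zpow (μ := μ) (b := b) 1 z 1
    rw [zpow_one, zpow_one, mul_one] at this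
    rw [this]
  rw [hU, hU] at h1
  have h2 : (b : ℂ) • μ.dproj (μ.toPerm z) (U (μ.toPerm z)) = (1 : ℂ) • μ.dproj z (U z) :=
    congrArg (fun p : TangentBundle 𝓘(ℂ, Fin n → ℂ) μ.HopfManifold => (p.2 : Fin n → ℂ)) h1
  rw [one_smul, ← map_smul, ← μ.dproj_toPerm z] at h2
  exact congrFun (μ.dproj_injective _ h2) i

/-- The map `z ↦ F [z, 1]` into `TX` is holomorphic. Near `z₀` its fibre coordinate in the
trivialization at `π z₀` is `U` multiplied by a constant invertible matrix, which can be undone. -/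
theorem mdifferentiableAt_lift (z₀ : puncturedSpace n) :
    MDifferentiableAt 𝓘(ℂ, Fin n → ℂ) 𝓘(ℂ, Fin n → ℂ) U z₀ := by
  have h1 : MDifferentiableAt 𝓘(ℂ, Fin n → ℂ) 𝓘(ℂ, Fin n → ℂ).tangent
      (fun z => F.toFun (LineBundle.mk μ b z 1)) z₀ := by
    have h2 : MDifferentiableAt (𝓘(ℂ, Fin n → ℂ).prod 𝓘(ℂ, ℂ)) 𝓘(ℂ, Fin n → ℂ).tangent
        (fun p : puncturedSpace n × ℂ => F.toFun (LineBundle.mk μ b p.1 p.2)) (z₀, 1) :=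
      (F.holomorphic _).comp _ ((μ.contMDiff_lineBundle_mk b _).mdifferentiableAt (by simp))
    exact MDifferentiableAt.comp (f := fun z : puncturedSpace n => (z, (1 : ℂ))) z₀ h2
      (mdifferentiableAt_id.prodMk mdifferentiableAt_const)
  have h3 := ((mdifferentiableAt_totalSpace 𝓘(ℂ, Fin n → ℂ) _).mp h1).2
  obtain ⟨k, hk⟩ := μ.exists_mfderiv_extChartAt_dproj z₀
  have h4 : MDifferentiableAt 𝓘(ℂ, Fin n → ℂ) 𝓘(ℂ, Fin n → ℂ) (fun z => μ.powCLM k (U z)) z₀ := by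
    refine h3.congr_of_eventuallyEq ?_
    filter_upwards [hk] with z hz
    rw [hU, hU, one_smul, one_smul]
    exact (hz.2 (U z)).symm.trans 
      (TangentBundle.trivializationAt_apply_snd (E := Fin n → ℂ) (I := 𝓘(ℂ, Fin n → ℂ)) hz.1 _).symm
  have h5 := ((μ.powCLM (-k)).differentiableAt (x := μ.powCLM k (U z₀))).mdifferentiableAt.comp
    z₀ h4
  refine h5.congr_of_eventuallyEq (Filter.Eventually.of_forall fun z => ?_)
  exact (μ.powCLM_neg_apply_apply k (U z)).symm

/-- Every point of `L_b` over `π z` can be written `[z, c]`: a representative over `f ^ k z` is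
moved back by dividing its fibre coordinate by `b ^ k`. -/
theorem tangentLine_eq_span_lift (z : puncturedSpace n) :
    F.tangentLine (μ.proj z) = (Submodule.span ℂ {μ.dproj z (U z)} : Set (Fin n → ℂ)) := by
  have key : ∀ u : Fin n → ℂ, u ∈ (F.tangentLine (μ.proj z) : Set (Fin n → ℂ)) ↔
      ∃ c : ℂ, c • μ.dproj z (U z) = u := ?_
  · exact Set.ext fun u : Fin n → ℂ =>
      (key u).trans (Submodule.mem_span_singleton (M := Fin n → ℂ)).symm
  intro u
  constructor
  · rintro ⟨q, hq⟩
    induction q using Quotient.inductionOn with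
    | h p =>
    have hq' : F.toFun (LineBundle.mk μ b p.1 p.2) = ⟨μ.proj z, u⟩ := hq
    have h1 : μ.proj p.1 = μ.proj z := by
      rw [hU] at hq'
      exact congrArg Bundle.TotalSpace.proj hq'
    obtain ⟨k, hk⟩ := exists_toPerm_zpow_of_proj_eq h1
    have h2 := LineBundle.mk_toPerm_zpow (μ := μ) (b := b) k z (((b : ℂ) ^ k)⁻¹ * p.2)
    rw [mul_inv_cancel_left₀ (zpow_ne_zero k b.ne_zero), ← hk] at h2
    rw [h2, hU] at hq'
    exact ⟨_, congrArg
      (fun p : TangentBundle 𝓘(ℂ, Fin n → ℂ) μ.HopfManifold => (p.2 : Fin n → ℂ)) hq'⟩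
  · rintro ⟨c, rfl⟩
    exact ⟨_, hU z c⟩

theorem isInducedBy_of_smul_lift {v : (Fin n → ℂ) → Fin n → ℂ} {t : ℂ} (ht : t ≠ 0)
    (hv : ∀ z : puncturedSpace n, U z = t • v z.1) : F.IsInducedBy v := by
  intro z
  rw [tangentLine_eq_span_lift hU z, hv z, map_smul]
  exact congrArg _ (Submodule.span_singleton_smul_eq (IsUnit.mk0 t ht) (μ.dproj z (v z.1)))

end Foliation

/-- The scalar `t` permits normalizing the inducing field, for instance from `t ∂/∂z_j` to `∂/∂z_j`.
-/
theorem Foliation.exists_polynomial_lift (F : μ.Foliation b) (hn : 2 ≤ n) :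
    ∃ p : Fin n → MvPolynomial (Fin n) ℂ, μ.IsSemiInvariant b p ∧
      ∀ (v : (Fin n → ℂ) → Fin n → ℂ) (t : ℂ), t ≠ 0 →
        (∀ z i, MvPolynomial.eval z (p i) = t * v z i) → F.IsInducedBy v := by
  classical
  obtain ⟨U, hU0, hU⟩ := F.exists_lift
  let V : (Fin n → ℂ) → Fin n → ℂ := fun z => if hz : z ≠ 0 then U ⟨z, hz⟩ else 0
  have hV : ∀ w : puncturedSpace n, V w.1 = U w := fun w => dif_pos w.2
  have hp : ∀ i, ∃ p : MvPolynomial (Fin n) ℂ,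
      (∀ z, z ≠ 0 → V z i = MvPolynomial.eval z p) ∧
        ∀ α, p.coeff α ≠ 0 → μ.character α = (b : ℂ)⁻¹ * μ.mult i := by
    intro i
    refine μ.exists_mvPolynomial_of_equivariant hn (h := fun z => V z i)
      (mul_ne_zero (inv_ne_zero b.ne_zero) (μ.mult_ne_zero i)) (fun z hz => ?_) fun z hz => ?_
    · exact differentiableAt_pi.mp (puncturedSpace.differentiableAt_of_mdifferentiableAt
        (z := ⟨z, hz⟩) (mdifferentiableAt_lift hU _) hV) i
    · have h1 := lift_toPerm hU ⟨z, hz⟩ i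
      rw [← hV, ← hV] at h1
      rw [mul_assoc, eq_inv_mul_iff_mul_eq₀ b.ne_zero]
      exact h1
  choose p hpV hpc using hp
  refine ⟨p, ⟨fun i α hα => ?_, fun z hz => ?_⟩, fun v t ht hv => ?_⟩
  · rw [hpc i α hα, mul_inv_cancel_left₀ b.ne_zero]
  · obtain ⟨i, hi⟩ := Function.ne_iff.mp (hU0 ⟨z, hz⟩)
    refine ⟨i, ?_⟩
    rw [← hpV i z hz, hV ⟨z, hz⟩]
    exact hi
  · refine isInducedBy_of_smul_lift hU ht fun z => funext fun i => ?_
    rw [← hV, hpV i z.1 z.2, hv]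
    rfl

end DiagonalContraction

/-! ### The generic, intermediary and classical cases -/

namespace DiagonalContraction

variable {n : ℕ} {μ : DiagonalContraction n} {b : ℂˣ}

theorem IsGeneric.isReduction (h : μ.IsGeneric) : μ.IsReduction id :=
  ⟨fun _ => rfl, by simpa using h.2⟩

/-- The representative of an index in the intermediary case: the first index for `i ≤ r`. -/
def intermediaryRep {n : ℕ} (r : ℕ) (i : Fin n) : Fin n :=
  if (i : ℕ) < r then ⟨0, i.pos⟩ else i

theorem intermediaryRep_of_lt {r : ℕ} {i : Fin n} (h : (i : ℕ) < r) :
    intermediaryRep r i = ⟨0, i.pos⟩ := if_pos h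

theorem intermediaryRep_of_le {r : ℕ} {i : Fin n} (h : r ≤ (i : ℕ)) :
    intermediaryRep r i = i := if_neg h.not_gt

theorem intermediaryRep_eq_iff_of_le {r : ℕ} (hr : 2 ≤ r) {i l : Fin n} (h : r ≤ (i : ℕ)) :
    intermediaryRep r l = intermediaryRep r i ↔ l = i := by
  rw [intermediaryRep_of_le h]
  rcases lt_or_ge (l : ℕ) r with hl | hl
  · rw [intermediaryRep_of_lt hl, Fin.ext_iff, Fin.ext_iff]
    simp only
    omega
  · rw [intermediaryRep_of_le hl]

theorem intermediaryRep_eq_iff_of_lt {r : ℕ} {i l : Fin n} (h : (i : ℕ) < r) :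
    intermediaryRep r l = intermediaryRep r i ↔ (l : ℕ) < r := by
  rw [intermediaryRep_of_lt h]
  rcases lt_or_ge (l : ℕ) r with hl | hl
  · simp [intermediaryRep_of_lt hl, hl]
  · rw [intermediaryRep_of_le hl, Fin.ext_iff]
    simp only
    omega

theorem intermediaryRep_mem (r : ℕ) (i : Fin n) :
    intermediaryRep r i ∈ intermediaryIndices n r := by
  simp only [intermediaryIndices, Finset.mem_filter, Finset.mem_univ, true_and]
  rcases lt_or_ge (i : ℕ) r with hi | hi
  · left; rw [intermediaryRep_of_lt hi]
  · right; rwa [intermediaryRep_of_le hi]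

theorem IsIntermediary.isReduction {r : ℕ} (h : μ.IsIntermediary r) :
    μ.IsReduction (intermediaryRep r) := by
  obtain ⟨hr, -, heq, hS⟩ := h
  refine ⟨fun i => ?_, ?_⟩
  · rcases lt_or_ge (i : ℕ) r with hi | hi
    · rw [intermediaryRep_of_lt hi]
      exact heq _ _ (by simp only; omega) hi
    · rw [intermediaryRep_of_le hi]
  · convert hS
    ext i
    simp only [Finset.mem_image, Finset.mem_univ, true_and]
    constructor
    · rintro ⟨j, rfl⟩
      exact intermediaryRep_mem r j
    · intro hi
      refine ⟨i, ?_⟩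
      simp only [intermediaryIndices, Finset.mem_filter, Finset.mem_univ, true_and] at hi
      rcases hi with hi | hi
      · rw [intermediaryRep_of_lt (by omega), Fin.ext_iff, hi]
      · exact intermediaryRep_of_le hi

/-- If `b` is the multiplier of an index that is alone in its class, then the foliation is induced
by a constant coordinate vector field. -/
theorem Foliation.isInducedBy_single {p : Fin n → MvPolynomial (Fin n) ℂ} {F : μ.Foliation b}
    (hp : μ.IsSemiInvariant b p)
    (hF : ∀ (v : (Fin n → ℂ) → Fin n → ℂ) (t : ℂ), t ≠ 0 →
      (∀ z i, MvPolynomial.eval z (p i) = t * v z i) → F.IsInducedBy v)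
    {τ : Fin n → Fin n} (hτ : μ.IsReduction τ) {j : Fin n} (hj : ∀ i, τ i = τ j → i = j)
    (hb : (b : ℂ) = μ.mult j) : F.IsInducedBy fun _ => Pi.single j 1 := by
  have : Nonempty (Fin n) := ⟨j⟩
  have h0 : ∀ i, i ≠ j → (p i).coeff 0 = 0 := fun i hi =>
    hp.coeff_zero_eq_zero_of_mult hτ hb fun h => hi (hj i h)
  obtain ⟨i, hi⟩ := hp.exists_coeff_zero_ne_zero_of_mult hτ hb
  obtain rfl : i = j := by
    by_contra h
    exact hi (h0 i h)
  refine hF _ ((p i).coeff 0) hi fun z l => ?_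
  rw [hp.eq_C_of_mult hτ hb l, MvPolynomial.eval_C]
  by_cases hl : l = i
  · subst hl; simp
  · rw [h0 l hl, Pi.single_eq_of_ne hl, mul_zero]

end DiagonalContraction

open DiagonalContraction in
theorem foliation_of_isClassical {n : ℕ} (hn : 3 ≤ n) {μ : DiagonalContraction n} {b : ℂˣ}
    (F : μ.Foliation b) {a : ℂ} (ha : μ.IsClassical a) :
    ∃ m : ℤ, -1 ≤ m ∧ (b : ℂ) = a ^ (-m) ∧
      ∃ g : Fin n → MvPolynomial (Fin n) ℂ,
        (∀ i, (g i).IsHomogeneous (m + 1).toNat) ∧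
        (0 ≤ m → {z : Fin n → ℂ | ∀ i, MvPolynomial.eval z (g i) = 0} = {0}) ∧
        (m = -1 → {z : Fin n → ℂ | ∀ i, MvPolynomial.eval z (g i) = 0} = ∅) ∧
        F.IsInducedBy fun z i => MvPolynomial.eval z (g i) := by
  have : Nonempty (Fin n) := ⟨⟨0, by omega⟩⟩
  obtain ⟨p, hp, hF⟩ := F.exists_polynomial_lift (by omega)
  obtain ⟨d, hd, hhom⟩ := hp.exists_isHomogeneous ha
  have ha0 : a ≠ 0 := ha (Classical.arbitrary _) ▸ μ.mult_ne_zero _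
  -- The common degree `d` is `m + 1`, so `d ≥ 0` is the bound `m ≥ -1`.
  refine ⟨d - 1, by omega, ?_, p, fun i => ?_, fun hm => ?_, fun hm => ?_,
    hF _ 1 one_ne_zero fun z i => (one_mul _).symm⟩
  · rw [neg_sub, zpow_sub₀ ha0, zpow_one, zpow_natCast, eq_div_iff (pow_ne_zero _ ha0), hd]
  · convert hhom i using 1
    omega
  · ext z
    rw [Set.mem_ofPred_eq, Set.mem_singleton_iff]
    constructor
    · intro h
      by_contra hz
      obtain ⟨i, hi⟩ := hp.exists_ne_zero z hz
      exact hi (h i)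
    · rintro rfl i
      rw [MvPolynomial.eval_zero, MvPolynomial.constantCoeff_eq]
      exact (hhom i).coeff_eq_zero (by rw [map_zero]; omega)
  · obtain rfl : d = 0 := by omega
    rw [Set.eq_empty_iff_forall_notMem]
    intro z hz
    -- In degree 0 all components are constant, so one that is nonzero at `(1, …, 1)` is nonzero at
    -- the origin as well.
    obtain ⟨i, hi⟩ := hp.exists_ne_zero (fun _ => 1) (Function.ne_iff.mpr
      ⟨Classical.arbitrary _, by simp⟩)
    have h1 := hz i
    rw [MvPolynomial.totalDegree_eq_zero_iff_eq_C.mp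
      ((hhom i).totalDegree_le.antisymm (by simp))] at h1 hi
    rw [MvPolynomial.eval_C] at h1 hi
    exact hi h1

open DiagonalContraction in
theorem foliation_of_isGeneric {n : ℕ} (hn : 3 ≤ n) {μ : DiagonalContraction n} {b : ℂˣ}
    (F : μ.Foliation b) (h : μ.IsGeneric) :
    ((b : ℂ) = 1 ∨ ∃ j, (b : ℂ) = μ.mult j) ∧
      ((b : ℂ) = 1 →
        ∃ c : Fin n → ℂ, (∀ i, c i ≠ 0) ∧ F.IsInducedBy fun z i => c i * z i) ∧
      (∀ j, (b : ℂ) = μ.mult j → F.IsInducedBy fun _ => Pi.single j 1) := by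
  obtain ⟨p, hp, hF⟩ := F.exists_polynomial_lift (by omega)
  have hτ := h.isReduction
  refine ⟨?_, fun hb => ?_, fun j hb => Foliation.isInducedBy_single hp hF hτ (fun i hi => hi) hb⟩
  · exact hτ.eq_one_or_eq_mult hp.exists_mul_pow_eq (j := ⟨0, by omega⟩) (j' := ⟨1, by omega⟩)
      (by simp)
  · have hev : ∀ z i, MvPolynomial.eval z (p i) = (p i).coeff (Finsupp.single i 1) * z i := by
      intro z i
      rw [hp.eval_eq_sum_of_one hτ hb]
      simp [Finset.filter_eq']
    refine ⟨fun i => (p i).coeff (Finsupp.single i 1), fun i hi => ?_,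
      hF _ 1 one_ne_zero fun z i => by rw [hev, one_mul]⟩
    -- At `e_i` the diagonal field has the value `c_i e_i`, which must not vanish.
    obtain ⟨l, hl⟩ := hp.exists_ne_zero (Pi.single i 1) (by simp)
    rw [hev] at hl
    by_cases hli : l = i
    · subst hli
      exact hl (mul_eq_zero_of_left hi _)
    · exact hl (by rw [Pi.single_eq_of_ne hli, mul_zero])

open DiagonalContraction in
theorem foliation_of_isIntermediary {n : ℕ} (hn : 3 ≤ n) {μ : DiagonalContraction n} {b : ℂˣ}
    (F : μ.Foliation b) {r : ℕ} (h : μ.IsIntermediary r) :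
    ((b : ℂ) = 1 ∨ ∃ j ∈ intermediaryIndices n r, (b : ℂ) = μ.mult j) ∧
      ((b : ℂ) = 1 →
        ∃ (A : Matrix (Fin n) (Fin n) ℂ) (c : Fin n → ℂ),
          F.IsInducedBy (blockLinearField r A c)) ∧
      (∀ i : Fin n, (i : ℕ) = 0 → (b : ℂ) = μ.mult i →
        ∃ c : Fin n → ℂ, (∃ k, c k ≠ 0) ∧ (∀ k : Fin n, r ≤ (k : ℕ) → c k = 0) ∧
          F.IsInducedBy fun _ => c) ∧
      (∀ j : Fin n, r ≤ (j : ℕ) → (b : ℂ) = μ.mult j →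
        F.IsInducedBy fun _ => Pi.single j 1) := by
  have : Nonempty (Fin n) := ⟨⟨0, by omega⟩⟩
  obtain ⟨p, hp, hF⟩ := F.exists_polynomial_lift (by omega)
  have hτ := h.isReduction
  obtain ⟨hr, hrn, -, -⟩ := h
  refine ⟨?_, fun hb => ?_, fun s hs hb => ?_, fun j hj hb =>
    Foliation.isInducedBy_single hp hF hτ
      (fun i hi => (intermediaryRep_eq_iff_of_le hr hj).mp hi) hb⟩
  -- Counted from 0, the index `r` is the first one outside the block of equal multipliers, so 0 and
  -- `r` lie in different classes.
  · refine (hτ.eq_one_or_eq_mult hp.exists_mul_pow_eq (j := ⟨0, by omega⟩) (j' := ⟨r, by omega⟩)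
      ?_).imp_right ?_
    · rw [Ne, intermediaryRep_eq_iff_of_le hr (by simp), Fin.ext_iff]
      simp only
      omega
    · rintro ⟨i, hi⟩
      exact ⟨_, intermediaryRep_mem r i, hi.trans (hτ.mult_eq i).symm⟩
  -- The class of `i` is the whole block if `i < r` and `{i}` otherwise. So the linear coefficients
  -- serve as the matrix in the block and their diagonal as `c` outside it.
  · refine ⟨fun i l => (p i).coeff (Finsupp.single l 1),
      fun i => (p i).coeff (Finsupp.single i 1), hF _ 1 one_ne_zero fun z i => ?_⟩
    rw [hp.eval_eq_sum_of_one hτ hb, one_mul]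
    unfold blockLinearField
    split_ifs with hi
    · simp only [intermediaryRep_eq_iff_of_lt hi]
    · simp [intermediaryRep_eq_iff_of_le hr (not_lt.mp hi), Finset.filter_eq']
  · refine ⟨fun k => (p k).coeff 0, hp.exists_coeff_zero_ne_zero_of_mult hτ hb, fun k hk => ?_,
      hF _ 1 one_ne_zero fun z i => ?_⟩
    · refine hp.coeff_zero_eq_zero_of_mult hτ hb fun heq => ?_
      have := (intermediaryRep_eq_iff_of_le hr hk).mp heq.symm
      subst this
      omega
    · rw [hp.eq_C_of_mult hτ hb i, MvPolynomial.eval_C, one_mul, MvPolynomial.coeff_C, if_pos rfl]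

theorem theorem1 {n : ℕ} (hn : 3 ≤ n) (μ : DiagonalContraction n) (b : ℂˣ)
    (F : μ.Foliation b) :
    (∀ a : ℂ, μ.IsClassical a →
      ∃ m : ℤ, -1 ≤ m ∧ (b : ℂ) = a ^ (-m) ∧
        ∃ g : Fin n → MvPolynomial (Fin n) ℂ,
          (∀ i, (g i).IsHomogeneous (m + 1).toNat) ∧
          (0 ≤ m → {z : Fin n → ℂ | ∀ i, MvPolynomial.eval z (g i) = 0} = {0}) ∧
          (m = -1 → {z : Fin n → ℂ | ∀ i, MvPolynomial.eval z (g i) = 0} = ∅) ∧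
          F.IsInducedBy fun z i => MvPolynomial.eval z (g i)) ∧
    (μ.IsGeneric →
      ((b : ℂ) = 1 ∨ ∃ j, (b : ℂ) = μ.mult j) ∧
      ((b : ℂ) = 1 →
        ∃ c : Fin n → ℂ, (∀ i, c i ≠ 0) ∧ F.IsInducedBy fun z i => c i * z i) ∧
      (∀ j, (b : ℂ) = μ.mult j → F.IsInducedBy fun _ => Pi.single j 1)) ∧
    (∀ r : ℕ, μ.IsIntermediary r →
      ((b : ℂ) = 1 ∨
        ∃ j ∈ DiagonalContraction.intermediaryIndices n r, (b : ℂ) = μ.mult j) ∧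
      ((b : ℂ) = 1 →
        ∃ (A : Matrix (Fin n) (Fin n) ℂ) (c : Fin n → ℂ),
          F.IsInducedBy (blockLinearField r A c)) ∧
      (∀ i : Fin n, (i : ℕ) = 0 → (b : ℂ) = μ.mult i →
        ∃ c : Fin n → ℂ, (∃ k, c k ≠ 0) ∧ (∀ k : Fin n, r ≤ (k : ℕ) → c k = 0) ∧
          F.IsInducedBy fun _ => c) ∧
      (∀ j : Fin n, r ≤ (j : ℕ) → (b : ℂ) = μ.mult j →
        F.IsInducedBy fun _ => Pi.single j 1)) :=
  ⟨fun _ ha => foliation_of_isClassical hn F ha, foliation_of_isGeneric hn F,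
    fun _ h => foliation_of_isIntermediary hn F h⟩
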